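/- **Setting.** Let $n\ge 0$, $(x_0,y_0)\in\mathbb R^2$, $\mathcal D_0=[x_0,\infty)\times[y_0,\infty)$, let $g:[x_0,\infty)\to[y_0,\infty]$ be (Lebesgue) measurable and $S=\{(x,y)\in\mathcal D_0: y\ge g(x)\}$. Let $u_X,u_Y\ge 0$ and, for $k=1,\dots,n$, let $0\le a_k\le b_k\le 1$, $x_0\le x_{1k}\le x_{2k}\le\infty$, $y_0\le y_{1k}\le y_{2k}\le\infty$ with $x_{1k},y_{1k}<\infty$. The optimal value of a maximization problem is the supremum of its objective over its feasible set ($-\infty$ if the problem is infeasible). *The OU-DRO problem.* For $c>0$, maximize $P((X,Y)\in S)$ over the densities $f:\mathcal D_0\to[0,\infty]$ of (truncated) distributions $P$ of $(X,Y)$ on $\mathcal D_0$ subject to $\bar F(x_0,y_0):=P(X\ge x_0,Y\ge y_0)=c$, $\int_{y_0}^\infty f(x_0,y)\,dy\le u_X$, $\int_{x_0}^\infty f(x,y_0)\,dx\le u_Y$, $a_k\bar F(x_0,y_0)\le P(x_{1k}\le X\le x_{2k},\,y_{1k}\le Y\le y_{2k})\le b_k\bar F(x_0,y_0)$ for $k=1,\dots,n$,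 and orthounimodality: $f(x',y')\ge f(x,y)$ whenever $x_0\le x'\le x$ and $y_0\le y'\le y$. *Step functions.* Put $N=12n+3$ and $\Theta=\{(z,w)\in\mathbb R^N\times\mathbb R^N: z_i>0\ (1\le i\le N),\ w_1>0,\ w_j\ge 0\ (2\le j\le N)\}\cong(0,\infty)^{12n+4}\times[0,\infty)^{12n+2}$. For $(z,w)\in\Theta$ let $H_i=\sum_{j=1}^{N+1-i}w_j$ and $s_i=\sum_{j=1}^{i}z_j$, so $s_0=0$. Let $R_{z,w}$ be the set of $(x,y)\in\mathcal D_0$ such that $y\le y_0+H_i$, where $i$ is the index with $x_0+s_{i-1}<x\le x_0+s_i$ (and $i=1$ if $x=x_0$); points with $x>x_0+s_N$ do not belong to $R_{z,w}$. Let $W_{step}(z,w)$ be the uniform distribution on $R_{z,w}$. Put $A(z,w)=\sum_{i=1}^N z_iH_i$ and $$\phi=\frac1A\sum_{i=1}^N\int_{x_0+s_{i-1}}^{x_0+s_i}(y_0+H_i-g(x))_+\,dx,\qquad \psi_X=\frac{\sum_{j=1}^N w_j}{A},\qquad \psi_Y=\frac{\sum_{i=1}^N z_i}{A},$$ $$\chi_k=\frac1A\sum_{i=1}^N\int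 I\big(s_{i-1}<x-x_0\le s_i,\ x_{1k}\le x\le x_{2k}\big)\big(\min(y_0+H_i,y_{2k})-\min(y_0+H_i,y_{1k})\big)\,dx .$$ *The moment problem.* For $c>0$, maximize $c\,E_Q[\phi(Z,W)]$ over the probability distributions $Q$ of $(Z,W)\in\Theta$ subject to $E_Q[\psi_X]\le u_X/c$, $E_Q[\psi_Y]\le u_Y/c$ and $a_k\le E_Q[\chi_k]\le b_k$, $k=1,\dots,n$. *The nonlinear program.* For $c>0$, maximize $c\sum_{l=1}^{n+3}p_l\,\phi(z_l,w_l)$ over $p\in[0,\infty)^{n+3}$ with $\sum_l p_l=1$ and $(z_l,w_l)\in\Theta$, $l=1,\dots,n+3$, subject to $\sum_l p_l\psi_X(z_l,w_l)\le u_X/c$, $\sum_l p_l\psi_Y(z_l,w_l)\le u_Y/c$ and $a_k\le\sum_l p_l\chi_k(z_l,w_l)\le b_k$, $k=1,\dots,n$. For a distribution $Q$ on $\Theta$ and $c>0$, put $$P_{c,Q}=c\int W_{step}(z,w)\,dQ(z,w),\qquad f_{c,Q}(x,y)=c\int\frac{\mathbf 1\{(x,y)\in R_{z,w}\}}{\lambda(R_{z,w})}\,dQ(z,w),$$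 where $\lambda$ is Lebesgue measure. **Theorem.** (1) Let $c>0$. The OU-DRO problem, the moment problem and the nonlinear program have the same optimal value, and the optimal value of the OU-DRO problem does not change if only densities that are finite everywhere on $\mathcal D_0$ are admitted. If $Q^*$ is an optimal solution of the moment problem, then $f_{c,Q^*}$ is a density of $P_{c,Q^*}$ and an optimal solution of the OU-DRO problem. (2) Let $0\le l_{\bar F}\le u_{\bar F}$. Consider the OU-DRO problem with the constraint $\bar F(x_0,y_0)=c$ replaced by $l_{\bar F}\le\bar F(x_0,y_0)\le u_{\bar F}$, and the nonlinear program with the additional decision variable $c>0$ and the additional constraint $l_{\bar F}\le c\le u_{\bar F}$. If $l_{\bar F}=0$, suppose for the next sentence that this nonlinear program is feasible. Then the two problems have the same optimal value, and that of the OU-DRO problem does not change if only densities that are finite everywhere on $\mathcal D_0$ are admitted. If $(c^*,p^*,z^*,w^*)$ is an optimal solution of this nonlinear program and $Q=\sum_{l=1}^{n+3}p_l^*\,\delta_{(z_l^*,w_l^*)}$, then $f_{c^*,Q}$ is a density of $P_{c^*,Q}$, is finite everywhere, and is an optimal solution of this OU-DRO problem. -/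

import Mathlib

open MeasureTheory Set
open scoped ENNReal

noncomputable section

namespace OUDRO

/-- The data of a bivariate orthounimodal DRO problem with `n` moment constraints, apart from the
bound(s) on the tail mass: the mode `(x0, y0)`, the function `g` whose epigraph is the rare event,
the bounds `uX`, `uY` on the marginal densities, and the boxes
`[x1 i, x2 i] × [y1 i, y2 i]` with the bounds `a i`, `b i` on their conditional probabilities.
The upper end points of the boxes, and the values of `g`, may be infinite. -/
structure Data (n : ℕ) where
  x0 : ℝ
  y0 : ℝ
  g : ℝ → EReal
  uX : ℝ
  uY : ℝ
  a : Fin n → ℝ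
  b : Fin n → ℝ
  x1 : Fin n → ℝ
  x2 : Fin n → EReal
  y1 : Fin n → ℝ
  y2 : Fin n → EReal

variable {n : ℕ} (D : Data n)

/-! ### The infinite-dimensional problem -/

/-- The tail region `{(x, y) : x ≥ x0, y ≥ y0}`. -/
def Data.tail : Set (ℝ × ℝ) := {q | D.x0 ≤ q.1 ∧ D.y0 ≤ q.2}

/-- The rare event `S`. -/
def Data.rareEvent : Set (ℝ × ℝ) := {q | q ∈ D.tail ∧ D.g q.1 ≤ (q.2 : EReal)}

/-- The box of the `k`-th moment constraint. -/
def Data.box (k : Fin n) : Set (ℝ × ℝ) :=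
  {q | D.x1 k ≤ q.1 ∧ (q.1 : EReal) ≤ D.x2 k ∧ D.y1 k ≤ q.2 ∧ (q.2 : EReal) ≤ D.y2 k}

/-- The (truncated) distribution on the tail region with Lebesgue density `f`. -/
def Data.dist (f : ℝ × ℝ → ℝ≥0∞) : Measure (ℝ × ℝ) :=
  (volume.restrict D.tail).withDensity f

/-- The objective `P((X, Y) ∈ S)`. -/
def Data.ouObj (f : ℝ × ℝ → ℝ≥0∞) : ℝ≥0∞ := D.dist f D.rareEvent

/-- The tail probability `F̄(x0, y0) = P(X ≥ x0, Y ≥ y0)`. -/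
def Data.tailProb (f : ℝ × ℝ → ℝ≥0∞) : ℝ≥0∞ := D.dist f D.tail

/-- All constraints of the OU-DRO problem on the density `f`, except the one on the value of the
tail probability. Densities take values in `[0, ∞]`; only their values on the tail region matter. -/
structure Data.IsOU (f : ℝ × ℝ → ℝ≥0∞) : Prop where
  measurable : AEMeasurable f (volume.restrict D.tail)
  marginalX : ∫⁻ y in Ici D.y0, f (D.x0, y) ≤ ENNReal.ofReal D.uX
  marginalY : ∫⁻ x in Ici D.x0, f (x, D.y0) ≤ ENNReal.ofReal D.uY
  lower : ∀ k, ENNReal.ofReal (D.a k) * D.tailProb f ≤ D.dist f (D.box k)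
  upper : ∀ k, D.dist f (D.box k) ≤ ENNReal.ofReal (D.b k) * D.tailProb f
  orthounimodal : ∀ x' x y' y : ℝ, D.x0 ≤ x' → x' ≤ x → D.y0 ≤ y' → y' ≤ y →
    f (x, y) ≤ f (x', y')

/-- The feasible densities of the OU-DRO problem with `F̄(x0, y0) = c`. -/
def Data.ouFeasible (c : ℝ) : Set (ℝ × ℝ → ℝ≥0∞) :=
  {f | D.IsOU f ∧ D.tailProb f = ENNReal.ofReal c}

/-- The feasible densities of the OU-DRO problem with `l ≤ F̄(x0, y0) ≤ u`. -/
def Data.ouFeasibleRange (l u : ℝ) : Set (ℝ × ℝ → ℝ≥0∞) :=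
  {f | D.IsOU f ∧ ENNReal.ofReal l ≤ D.tailProb f ∧ D.tailProb f ≤ ENNReal.ofReal u}

/-- The densities that are finite everywhere on the tail region. -/
def Data.realValued : Set (ℝ × ℝ → ℝ≥0∞) := {f | ∀ q ∈ D.tail, f q ≠ ∞}

/-! ### Optimal values and optimal solutions -/

/-- The optimal value of `max obj` over `feasible`; it is `-∞` if the problem is infeasible. -/
def optValue {α : Type} (feasible : Set α) (obj : α → ℝ≥0∞) : EReal :=
  ⨆ v ∈ feasible, ((obj v : ℝ≥0∞) : EReal)

/-- `v` is an optimal solution of `max obj` over `feasible`. -/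
def IsOptimal {α : Type} (feasible : Set α) (obj : α → ℝ≥0∞) (v : α) : Prop :=
  v ∈ feasible ∧ ∀ v' ∈ feasible, obj v' ≤ obj v

/-! ### Step functions with `12 n + 3` steps -/

/-- The number of steps. -/
abbrev steps (n : ℕ) : ℕ := 12 * n + 3

/-- The space of the vectors `(z, w)`. Indices start from `0` here. -/
abbrev Param (n : ℕ) : Type := (Fin (steps n) → ℝ) × (Fin (steps n) → ℝ)

/-- The index of the first coordinate. -/
def first (n : ℕ) : Fin (steps n) := ⟨0, by unfold steps; omega⟩

/-- The admissible parameters: all `z`'s and the first `w` are positive, and the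
other `w`'s are nonnegative. -/
def admissible (n : ℕ) : Set (Param n) :=
  {t | (∀ i, 0 < t.1 i) ∧ 0 < t.2 (first n) ∧ ∀ j, 0 ≤ t.2 j}

/-- Left end of the `i`-th step, relative to `x0`: the sum of the previous `z`'s. -/
def leftEnd (t : Param n) (i : Fin (steps n)) : ℝ := ∑ j with j < i, t.1 j

/-- Right end of the `i`-th step, relative to `x0`. -/
def rightEnd (t : Param n) (i : Fin (steps n)) : ℝ := ∑ j with j ≤ i, t.1 j

/-- Height of the `i`-th step above `y0`: with indices from `0`, the sum of the first
`12 n + 3 - i` of the `w`'s. -/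
def height (t : Param n) (i : Fin (steps n)) : ℝ :=
  ∑ j ∈ Finset.univ.filter (fun j : Fin (steps n) => (i : ℕ) + (j : ℕ) < steps n), t.2 j

/-- The sum of all `z i * w j` with `j` one of the first `12 n + 3 - i` indices. -/
def area (t : Param n) : ℝ :=
  ∑ i : Fin (steps n),
    ∑ j ∈ Finset.univ.filter (fun j : Fin (steps n) => (i : ℕ) + (j : ℕ) < steps n), t.1 i * t.2 j

/-- The interval on which the step function takes the value `y0 + height t i`: closed for the
first step, open on the left for the others. -/
def Data.stepInterval (t : Param n) (i : Fin (steps n)) : Set ℝ :=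
  if i = first n then Icc D.x0 (D.x0 + rightEnd t i)
  else Ioc (D.x0 + leftEnd t i) (D.x0 + rightEnd t i)

/-- The region `R_{z,w}` in the tail under the step function. -/
def Data.stepRegion (t : Param n) : Set (ℝ × ℝ) :=
  {q | D.y0 ≤ q.2 ∧ ∃ i, q.1 ∈ D.stepInterval t i ∧ q.2 ≤ D.y0 + height t i}

/-- `W_step(z, w)`: the uniform distribution on the region under the step function. -/
def Data.stepUniform (t : Param n) : Measure (ℝ × ℝ) :=
  ProbabilityTheory.cond volume (D.stepRegion t)

/-- `P = c ∫ W_step(z, w) dQ(z, w)`. -/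
def Data.IsStepMixture (P : Measure (ℝ × ℝ)) (c : ℝ) (Q : Measure (Param n)) : Prop :=
  ∀ B : Set (ℝ × ℝ), MeasurableSet B →
    P B = ENNReal.ofReal c * ∫⁻ t, D.stepUniform t B ∂Q

/-- The density `q ↦ c ∫ 1_{R_{z,w}}(q) / λ(R_{z,w}) dQ(z, w)` of `c ∫ W_step(z, w) dQ(z, w)`. -/
def Data.mixDensity (c : ℝ) (Q : Measure (Param n)) (q : ℝ × ℝ) : ℝ≥0∞ :=
  ENNReal.ofReal c *
    ∫⁻ t, (D.stepRegion t).indicator (fun _ => (volume (D.stepRegion t))⁻¹) q ∂Q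

/-! ### The four integrands of the moment problem -/

/-- The integrand of the objective. The positive part `(y - g x)₊` is
`((y : EReal) - g x).toENNReal`, which is `0` if `g x = ∞`. -/
def Data.objTerm (t : Param n) : ℝ≥0∞ :=
  (∑ i : Fin (steps n),
    ∫⁻ x in {x : ℝ | D.x0 + leftEnd t i < x ∧ x ≤ D.x0 + rightEnd t i},
      (((D.y0 + height t i : ℝ) : EReal) - D.g x).toENNReal) / ENNReal.ofReal (area t)

/-- The integrand of the constraint on the marginal density of `X`. -/
def xTerm (t : Param n) : ℝ≥0∞ := ENNReal.ofReal (∑ j, t.2 j) / ENNReal.ofReal (area t)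

/-- The integrand of the constraint on the marginal density of `Y`. -/
def yTerm (t : Param n) : ℝ≥0∞ := ENNReal.ofReal (∑ i, t.1 i) / ENNReal.ofReal (area t)

/-- The integrand of the `k`-th moment constraint. -/
def Data.boxTerm (k : Fin n) (t : Param n) : ℝ≥0∞ :=
  (∑ i : Fin (steps n),
    ∫⁻ _x in {x : ℝ | leftEnd t i < x - D.x0 ∧ x - D.x0 ≤ rightEnd t i ∧
        D.x1 k ≤ x ∧ (x : EReal) ≤ D.x2 k},
      (min ((D.y0 + height t i : ℝ) : EReal) (D.y2 k) -
        min ((D.y0 + height t i : ℝ) : EReal) ((D.y1 k : ℝ) : EReal)).toENNReal) /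
    ENNReal.ofReal (area t)

/-! ### The moment problem -/

/-- The feasible set of the moment problem: the distributions `Q` of `(Z, W)`. -/
def Data.momentFeasible (c : ℝ) : Set (Measure (Param n)) :=
  {Q | IsProbabilityMeasure Q ∧ (∀ᵐ t ∂Q, t ∈ admissible n) ∧
    ∫⁻ t, xTerm t ∂Q ≤ ENNReal.ofReal (D.uX / c) ∧
    ∫⁻ t, yTerm t ∂Q ≤ ENNReal.ofReal (D.uY / c) ∧
    ∀ k, ENNReal.ofReal (D.a k) ≤ ∫⁻ t, D.boxTerm k t ∂Q ∧
      ∫⁻ t, D.boxTerm k t ∂Q ≤ ENNReal.ofReal (D.b k)}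

/-- The objective of the moment problem. -/
def Data.momentObj (c : ℝ) (Q : Measure (Param n)) : ℝ≥0∞ :=
  ENNReal.ofReal c * ∫⁻ t, D.objTerm t ∂Q

/-! ### The nonlinear program -/

/-- The decision variables of the nonlinear program: weights `p l` and points `(z l, w l)`,
`l = 1, …, n + 3`. -/
structure Vars (n : ℕ) where
  p : Fin (n + 3) → ℝ
  z : Fin (n + 3) → Fin (steps n) → ℝ
  w : Fin (n + 3) → Fin (steps n) → ℝ

/-- The `l`-th support point. -/
def Vars.pt (v : Vars n) (l : Fin (n + 3)) : Param n := (v.z l, v.w l)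

/-- The discrete distribution with mass `p l` at `(z l, w l)`. -/
def Vars.discrete (v : Vars n) : Measure (Param n) :=
  ∑ l, ENNReal.ofReal (v.p l) • Measure.dirac (v.pt l)

/-- The feasible set of the nonlinear program for a given `c`. -/
def Data.nlpFeasible (c : ℝ) : Set (Vars n) :=
  {v | ∑ l, ENNReal.ofReal (v.p l) * xTerm (v.pt l) ≤ ENNReal.ofReal (D.uX / c) ∧
    ∑ l, ENNReal.ofReal (v.p l) * yTerm (v.pt l) ≤ ENNReal.ofReal (D.uY / c) ∧
    (∀ k, ENNReal.ofReal (D.a k) ≤ ∑ l, ENNReal.ofReal (v.p l) * D.boxTerm k (v.pt l) ∧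
      ∑ l, ENNReal.ofReal (v.p l) * D.boxTerm k (v.pt l) ≤ ENNReal.ofReal (D.b k)) ∧
    ∑ l, v.p l = 1 ∧ (∀ l, 0 ≤ v.p l) ∧
    (∀ l, 0 < v.w l (first n)) ∧ (∀ l j, 0 ≤ v.w l j) ∧ (∀ l i, 0 < v.z l i)}

/-- The objective of the nonlinear program. -/
def Data.nlpObj (c : ℝ) (v : Vars n) : ℝ≥0∞ :=
  ENNReal.ofReal c * ∑ l, ENNReal.ofReal (v.p l) * D.objTerm (v.pt l)

/-- The feasible set of the nonlinear program with the additional decision variable `c` and the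
additional constraint `l ≤ c ≤ u` (`c` is positive, as the constraints contain `uX / c`). -/
def Data.nlpFeasibleRange (l u : ℝ) : Set (ℝ × Vars n) :=
  {cv | 0 < cv.1 ∧ l ≤ cv.1 ∧ cv.1 ≤ u ∧ cv.2 ∈ D.nlpFeasible cv.1}

/-- The objective of the nonlinear program with the additional decision variable `c`. -/
def Data.nlpObjRange (cv : ℝ × Vars n) : ℝ≥0∞ := D.nlpObj cv.1 cv.2

end OUDRO

end

/-! The proof combines the layer cake formula, a Carathéodory reduction and a convexity argument.
Let `f` be a feasible density of mass `c > 0`. Its superlevel sets `{f > s}` are orthounimodal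
regions, so the distribution is a mixture of uniform laws on them, level `s` having weight `volume
{f > s} / c`. The two marginal densities, the `n` box probabilities and the objective, all divided
by `c`, become means of ratios under this law of `s` (for the marginals an upper bound for the mean
is enough). Fixing `n + 2` means and not decreasing one more is possible with `n + 3` atoms
(`exists_discrete_of_lintegral`).

Each of the `n + 3` regions is then replaced by a step region (`Data.IsLower.exists_step`). Its
upper boundary `h` is antitone. Cut the base interval where the abscissa passes a vertical side of a
box or `h` passes the level of a horizontal side: at most `4 n` cuts, hence at most `4 n + 1`
pieces, and on each piece the length inside a box is either independent of `h` or equal to `h` minus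
a constant. On one piece `h` is an average, over levels `t`, of two-valued antitone functions; two
levels suffice to keep the integral of `h` and not to decrease its integral over `{g ≤ h}`. Since `v
↦ (v - g)₊` is convex, the area in the rare event does not decrease either
(`exists_step_of_antitoneOn`). Three values per piece give `3 (4 n + 1) = 12 n + 3` steps. The range
of `h` is not enlarged, so neither the initial height nor the width grows while the area is
unchanged, and the marginal bounds survive.

Conversely, Tonelli's theorem shows that a mixture of uniform laws on step regions has a feasible
density with the objective value of the moment problem. This closes the cycle OU-DRO ≤ nonlinear
program ≤ moment problem ≤ OU-DRO. For a feasible point of the nonlinear program the density is a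
finite sum of finite functions, which gives the claims about densities finite everywhere. With
variable mass the same argument runs at the mass of the given density; mass zero is treated
separately. -/

/-! ### Carathéodory reduction: moments of a probability measure attained by few atoms -/

/-- A convex set in a finite-dimensional space that misses the origin lies in a closed half-space
through the origin. -/
theorem Convex.exists_ne_zero_forall_nonneg {E : Type*} [NormedAddCommGroup E] [NormedSpace ℝ E]
    [FiniteDimensional ℝ E] {C : Set E} (hC : Convex ℝ C) (hne : C.Nonempty) (h0 : (0 : E) ∉ C) :
    ∃ f : E →L[ℝ] ℝ, f ≠ 0 ∧ ∀ x ∈ C, 0 ≤ f x := by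
  by_cases hint : (interior C).Nonempty
  · obtain ⟨f, hf0, hf⟩ := geometric_hahn_banach_of_nonempty_interior_point hC
      (fun h => h0 (interior_subset h)) hint
    refine ⟨-f, neg_ne_zero.2 hf0, fun x hx => ?_⟩
    simpa using hf x hx
  -- With empty interior the set lies in a proper affine subspace. A nonzero functional vanishing on
  -- its direction is constant on the set, and its sign is free.
  · have hspan : affineSpan ℝ C ≠ ⊤ := by
      rwa [Ne, ← hC.interior_nonempty_iff_affineSpan_eq_top]
    have hdir : (vectorSpan ℝ C) < ⊤ := by
      rw [lt_top_iff_ne_top, ← direction_affineSpan]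
      intro h
      exact hspan ((AffineSubspace.direction_eq_top_iff_of_nonempty
        ((affineSpan_nonempty ℝ).2 hne)).1 h)
    obtain ⟨f, hf0, hf⟩ := Submodule.exists_le_ker_of_lt_top _ hdir
    obtain ⟨x0, hx0⟩ := hne
    have hconst : ∀ x ∈ C, f x = f x0 := by
      intro x hx
      have : f (x -ᵥ x0) = 0 := hf (vsub_mem_vectorSpan ℝ hx hx0)
      simpa [sub_eq_zero] using this
    rcases le_total 0 (f x0) with h | h
    · refine ⟨LinearMap.toContinuousLinearMap f, by simpa using hf0, fun x hx => ?_⟩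
      simpa [hconst x hx] using h
    · refine ⟨-LinearMap.toContinuousLinearMap f, by simpa using hf0, fun x hx => ?_⟩
      simpa [hconst x hx] using h

/-- If a random vector in a finite-dimensional space has mean zero, then the origin lies in the
convex hull of every set that contains almost all of its values. -/
theorem zero_mem_convexHull_of_integral_eq_zero {Ω : Type*} [MeasurableSpace Ω] (μ : Measure Ω)
    [IsProbabilityMeasure μ] (d : ℕ) : ∀ {E : Type} [NormedAddCommGroup E] [NormedSpace ℝ E]
    [FiniteDimensional ℝ E] (_ : Module.finrank ℝ E = d) (S : Set E) (f : Ω → E)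
    (_ : Integrable f μ) (_ : ∀ᵐ x ∂μ, f x ∈ S) (_ : ∫ x, f x ∂μ = 0),
    (0 : E) ∈ convexHull ℝ S := by
  induction d with
  | zero =>
    intro E _ _ _ hd S f _ hS _
    obtain ⟨x, hx⟩ := hS.exists
    have : Subsingleton E := Module.finrank_zero_iff.1 hd
    rw [Subsingleton.elim (0 : E) (f x)]
    exact subset_convexHull ℝ S hx
  | succ d ih =>
    intro E _ _ _ hd S f hf hS h0
    by_contra hcon
    have hne : (convexHull ℝ S).Nonempty := by
      obtain ⟨x, hx⟩ := hS.exists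
      exact ⟨f x, subset_convexHull ℝ S hx⟩
    -- The nonnegative variable `ℓ ∘ f` has mean zero, so it vanishes almost everywhere and `f`
    -- takes almost all its values in the hyperplane `ker ℓ`; induct on the dimension there. Weak
    -- separation is enough, so no closure of the hull is needed.
    obtain ⟨ℓ, hℓ0, hℓ⟩ := (convex_convexHull ℝ S).exists_ne_zero_forall_nonneg hne hcon
    have hnn : 0 ≤ᵐ[μ] fun x => ℓ (f x) := by
      filter_upwards [hS] with x hx using hℓ _ (subset_convexHull ℝ S hx)
    have hint : ∫ x, ℓ (f x) ∂μ = 0 := by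
      rw [ContinuousLinearMap.integral_comp_comm ℓ hf, h0, map_zero]
    have hz := (integral_eq_zero_iff_of_nonneg_ae hnn (ℓ.integrable_comp hf)).1 hint
    obtain ⟨π, hπ⟩ := ℓ.ker_closedComplemented_of_finiteDimensional_range
    have hdim : Module.finrank ℝ ℓ.ker = d := by
      have h1 := Module.Dual.finrank_ker_add_one_of_ne_zero (K := ℝ) (f := ℓ.toLinearMap)
        (fun h => hℓ0 (ContinuousLinearMap.coe_injective h))
      have h2 : Module.finrank ℝ ℓ.ker + 1 = Module.finrank ℝ E := h1
      omega
    have key := ih hdim (Subtype.val ⁻¹' S) (fun x => π (f x)) (π.integrable_comp hf)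
      (by
        filter_upwards [hS, hz] with x hx hx0
        have : π (f x) = ⟨f x, hx0⟩ := hπ ⟨f x, hx0⟩
        rw [this]
        exact hx)
      (by rw [ContinuousLinearMap.integral_comp_comm π hf, h0, map_zero])
    have himg : ((0 : ℓ.ker) : E) ∈ convexHull ℝ S := by
      have h3 : ℓ.ker.subtype '' convexHull ℝ (Subtype.val ⁻¹' S) ⊆ convexHull ℝ S := by
        rw [LinearMap.image_convexHull]
        apply convexHull_mono
        rintro _ ⟨y, hy, rfl⟩
        exact hy
      exact h3 ⟨_, key, rfl⟩
    exact hcon (by simpa using himg)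

/-- One can remove a point from a discrete distribution on more than `m + 1` points without changing
`m` given moments and without decreasing the mean of `G`. -/
theorem exists_remove_point {Ω : Type*} {m k : ℕ} (hk : m < k) (u : Ω → Fin m → ℝ) (G : Ω → ℝ)
    (p : Fin (k + 1) → ℝ) (ω : Fin (k + 1) → Ω) (hp : ∀ l, 0 ≤ p l) (hsum : ∑ l, p l = 1) :
    ∃ (q : Fin k → ℝ) (i : Fin (k + 1)), (∀ l, 0 ≤ q l) ∧ ∑ l, q l = 1 ∧
      (∀ j, ∑ l, q l * u (ω (i.succAbove l)) j = ∑ l, p l * u (ω l) j) ∧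
      ∑ l, p l * G (ω l) ≤ ∑ l, q l * G (ω (i.succAbove l)) := by
  -- More than `m + 1` vectors in a space of dimension `m + 1`. Moving the weights along a linear
  -- relation `a` keeps the total mass and all moments.
  have hdep : ¬ LinearIndependent ℝ (fun l : Fin (k + 1) => ((1 : ℝ), u (ω l))) := by
    intro h
    have := h.fintype_card_le_finrank
    simp at this
    omega
  obtain ⟨a, ha, i0, hi0⟩ := Fintype.not_linearIndependent_iff.1 hdep
  have hfst := congrArg Prod.fst ha
  have hsnd := congrArg Prod.snd ha
  simp only [Prod.smul_mk, Prod.fst_sum, Prod.snd_sum, smul_eq_mul, mul_one, Prod.fst_zero,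
    Prod.snd_zero] at hfst hsnd
  have hsnd' : ∀ j, ∑ l, a l * u (ω l) j = 0 := fun j => by
    have := congrFun hsnd j
    simpa [Finset.sum_apply] using this
  clear ha hsnd hdep
  -- The relation may be negated, so one moves in the direction in which the mean of `G` does not
  -- decrease.
  wlog hG : 0 ≤ ∑ l, a l * G (ω l) generalizing a
  · refine this (fun l => - a l) (by simpa using hi0) (by simpa using hfst) (fun j => ?_) ?_
    · simpa using hsnd' j
    · simp only [neg_mul, Finset.sum_neg_distrib]
      linarith
  have hneg : ∃ l, a l < 0 := by
    by_contra hcon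
    push Not at hcon
    exact hi0 ((Finset.sum_eq_zero_iff_of_nonneg (fun l _ => hcon l)).1 hfst i0 (Finset.mem_univ _))
  obtain ⟨l0, hl0⟩ := hneg
  -- The minimal ratio is the longest move that keeps all weights nonnegative; at its end the weight
  -- of `i` vanishes.
  obtain ⟨i, hi, hmin⟩ := Finset.exists_min_image (Finset.univ.filter fun l => a l < 0)
    (fun l => p l / (-a l)) ⟨l0, by simpa using hl0⟩
  simp only [Finset.mem_filter, Finset.mem_univ, true_and] at hi hmin
  set τ := p i / (-a i) with hτ
  have hτ0 : 0 ≤ τ := div_nonneg (hp i) (by linarith)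
  have hzero : p i + τ * a i = 0 := by
    rw [hτ]
    field_simp [hi.ne]
    ring
  have hnn : ∀ l, 0 ≤ p l + τ * a l := by
    intro l
    rcases lt_or_ge (a l) 0 with h | h
    · have := hmin l h
      rw [le_div_iff₀ (by linarith)] at this
      linarith
    · have := mul_nonneg hτ0 h
      linarith [hp l]
  have htrans : ∀ v : Fin (k + 1) → ℝ, ∑ l : Fin k, (p (i.succAbove l) + τ * a (i.succAbove l)) *
      v (i.succAbove l) = ∑ l, p l * v l + τ * ∑ l, a l * v l := by
    intro v
    have h1 : ∑ l, (p l + τ * a l) * v l = ∑ l, p l * v l + τ * ∑ l, a l * v l := by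
      rw [Finset.mul_sum, ← Finset.sum_add_distrib]
      exact Finset.sum_congr rfl fun l _ => by ring
    rw [← h1, Fin.sum_univ_succAbove _ i, hzero]
    simp
  refine ⟨fun l => p (i.succAbove l) + τ * a (i.succAbove l), i, fun l => hnn _, ?_, fun j => ?_, ?_⟩
  · simpa [hfst, hsum] using htrans 1
  · simpa [hsnd'] using htrans fun l => u (ω l) j
  · have := htrans fun l => G (ω l)
    have h2 := mul_nonneg hτ0 hG
    linarith

/-- Under a probability measure, `m` moments and the lower bound on the mean of a further function
are attained by a discrete distribution on `m + 1` points of a given set of full measure. -/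
theorem exists_discrete_of_integral {Ω : Type*} [MeasurableSpace Ω] (μ : Measure Ω)
    [IsProbabilityMeasure μ] {m : ℕ} (u : Fin m → Ω → ℝ) (G : Ω → ℝ) (hu : ∀ j, Integrable (u j) μ)
    (hG : Integrable G μ) {S : Set Ω} (hS : ∀ᵐ x ∂μ, x ∈ S) :
    ∃ (p : Fin (m + 1) → ℝ) (ω : Fin (m + 1) → Ω), (∀ l, 0 ≤ p l) ∧ ∑ l, p l = 1 ∧ (∀ l, ω l ∈ S) ∧
      (∀ j, ∑ l, p l * u j (ω l) = ∫ x, u j x ∂μ) ∧ ∫ x, G x ∂μ ≤ ∑ l, p l * G (ω l) := by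
  let Rep (k : ℕ) : Prop := ∃ (p : Fin k → ℝ) (ω : Fin k → Ω), (∀ l, 0 ≤ p l) ∧ ∑ l, p l = 1 ∧
    (∀ l, ω l ∈ S) ∧ (∀ j, ∑ l, p l * u j (ω l) = ∫ x, u j x ∂μ) ∧
    ∫ x, G x ∂μ ≤ ∑ l, p l * G (ω l)
  -- Padding with a point of weight zero: the first representation may have fewer than `m + 1`
  -- points.
  have hup : ∀ k, 0 < k → Rep k → Rep (k + 1) := by
    rintro k hk ⟨p, ω, hp, h1, hω, hu, hG⟩
    refine ⟨Fin.cons 0 p, Fin.cons (ω ⟨0, hk⟩) ω, ?_, ?_, ?_, ?_, ?_⟩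
    · intro l
      refine Fin.cases ?_ (fun l => ?_) l
      · simp
      · simpa using hp l
    · simpa [Fin.sum_univ_succ] using h1
    · intro l
      refine Fin.cases ?_ (fun l => ?_) l
      · simpa using hω _
      · simpa using hω l
    · intro j
      simpa [Fin.sum_univ_succ] using hu j
    · simpa [Fin.sum_univ_succ] using hG
  have hdown : ∀ k, m < k → Rep (k + 1) → Rep k := by
    rintro k hk ⟨p, ω, hp, h1, hω, hu, hG⟩
    obtain ⟨q, i, hq, hq1, hqu, hqG⟩ := exists_remove_point hk (fun x j => u j x) G p ω hp h1
    exact ⟨q, fun l => ω (i.succAbove l), hq, hq1, fun l => hω _, fun j => (hqu j).trans (hu j),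
      hG.trans hqG⟩
  suffices hex : ∃ k, Rep k by
    obtain ⟨k, hk⟩ := hex
    have hk0 : 0 < k := by
      rcases Nat.eq_zero_or_pos k with rfl | h
      · obtain ⟨p, _, _, h1, _⟩ := hk
        simp at h1
      · exact h
    have hlow : ∀ d, Rep (m + 1 + d) → Rep (m + 1) := by
      intro d
      induction d with
      | zero => exact id
      | succ d ih => exact fun h => ih (hdown (m + 1 + d) (by omega) h)
    have hhigh : ∀ d, Rep (k + d) := by
      intro d
      induction d with
      | zero => exact hk
      | succ d ih => exact hup (k + d) (by omega) ih
    exact hlow k (by have := hhigh (m + 1); rwa [add_comm] at this)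
  -- The centred vector of all the functions, `G` included, has mean zero, hence some finite
  -- combination matches every mean exactly. The mean of `G` can become larger only when points are
  -- removed.
  let f : Ω → (Fin m → ℝ) × ℝ := fun x => (fun j => u j x - ∫ y, u j y ∂μ, G x - ∫ y, G y ∂μ)
  have hf1 : ∀ j, Integrable (fun x => u j x - ∫ y, u j y ∂μ) μ := fun j =>
    (hu j).sub (integrable_const _)
  have hf2 : Integrable (fun x => G x - ∫ y, G y ∂μ) μ := hG.sub (integrable_const _)
  have hfi : Integrable f μ := (Integrable.of_eval hf1).prodMk hf2
  have h0 : ∫ x, f x ∂μ = 0 := by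
    have hpair : ∫ x, f x ∂μ = (∫ x, (fun j => u j x - ∫ y, u j y ∂μ) ∂μ,
        ∫ x, (G x - ∫ y, G y ∂μ) ∂μ) := integral_pair (Integrable.of_eval hf1) hf2
    rw [hpair, Prod.mk_eq_zero]
    constructor
    · funext j
      rw [eval_integral hf1]
      simp [integral_sub (hu j) (integrable_const _)]
    · simp [integral_sub hG (integrable_const _)]
  have hmem := zero_mem_convexHull_of_integral_eq_zero μ _ rfl (f '' S) f hfi
    (by filter_upwards [hS] with x hx using mem_image_of_mem f hx) h0
  rw [convexHull_eq] at hmem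
  obtain ⟨ι, t, w, z, hw, hw1, hz, hc⟩ := hmem
  have : Nonempty Ω := ⟨hS.exists.choose⟩
  choose! y hyS hyz using hz
  let e : Fin t.card ≃ t := t.equivFin.symm
  have htr : ∀ v : ι → ℝ, ∑ l, v (e l) = ∑ i ∈ t, v i := fun v => by
    rw [← Finset.sum_coe_sort t, ← e.sum_comp]
  have hc' : ∑ i ∈ t, w i • f (y i) = 0 := by
    rw [Finset.centerMass_eq_of_sum_1 _ _ hw1] at hc
    rw [← hc]
    exact Finset.sum_congr rfl fun i hi => by rw [hyz i hi]
  have hce : ∀ c : ℝ, ∀ v : Ω → ℝ, ∑ i ∈ t, w i * (v (y i) - c) = 0 →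
      ∑ l, w (e l) * v (y (e l)) = c := by
    intro c v hv
    rw [htr fun i => w i * v (y i)]
    simp only [mul_sub, Finset.sum_sub_distrib, ← Finset.sum_mul, hw1] at hv
    linarith
  refine ⟨t.card, fun l => w (e l), fun l => y (e l), fun l => hw _ (e l).2, (htr w).trans hw1,
    fun l => hyS _ (e l).2, fun j => hce _ (u j) ?_, (hce _ G ?_).ge⟩
  · have := congrFun (congrArg Prod.fst hc') j
    simpa [f, Prod.fst_sum, Finset.sum_apply] using this
  · have := congrArg Prod.snd hc'
    simpa [f, Prod.snd_sum] using this

/-- The version of `exists_discrete_of_integral` for functions with values in `[0, ∞]`. -/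
theorem exists_discrete_of_lintegral {Ω : Type*} [MeasurableSpace Ω] (μ : Measure Ω)
    [IsProbabilityMeasure μ] {m : ℕ} (u : Fin m → Ω → ℝ≥0∞) (G : Ω → ℝ≥0∞)
    (hu : ∀ j, AEMeasurable (u j) μ) (hG : AEMeasurable G μ)
    (hui : ∀ j, ∫⁻ x, u j x ∂μ ≠ ∞) (hGi : ∫⁻ x, G x ∂μ ≠ ∞) {S : Set Ω} (hS : ∀ᵐ x ∂μ, x ∈ S) :
    ∃ (p : Fin (m + 1) → ℝ) (ω : Fin (m + 1) → Ω), (∀ l, 0 ≤ p l) ∧ ∑ l, p l = 1 ∧ (∀ l, ω l ∈ S) ∧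
      (∀ j, ∑ l, ENNReal.ofReal (p l) * u j (ω l) = ∫⁻ x, u j x ∂μ) ∧
      ∫⁻ x, G x ∂μ ≤ ∑ l, ENNReal.ofReal (p l) * G (ω l) := by
  -- The atoms are also required to be points where all functions are finite, so that passing to
  -- `toReal` loses nothing there.
  have hfin : ∀ᵐ x ∂μ, x ∈ S ∩ {x | (∀ j, u j x < ∞) ∧ G x < ∞} := by
    filter_upwards [hS, ae_all_iff.2 fun j => ae_lt_top' (hu j) (hui j), ae_lt_top' hG hGi]
      with x h1 h2 h3 using ⟨h1, h2, h3⟩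
  obtain ⟨p, ω, hp, hp1, hω, hpu, hpG⟩ := exists_discrete_of_integral μ (fun j x => (u j x).toReal)
    (fun x => (G x).toReal) (fun j => integrable_toReal_of_lintegral_ne_top (hu j) (hui j))
    (integrable_toReal_of_lintegral_ne_top hG hGi) hfin
  have hconv : ∀ v : Ω → ℝ≥0∞, (∀ l, v (ω l) < ∞) →
      ∑ l, ENNReal.ofReal (p l) * v (ω l) = ENNReal.ofReal (∑ l, p l * (v (ω l)).toReal) := by
    intro v hv
    rw [ENNReal.ofReal_sum_of_nonneg fun l _ => mul_nonneg (hp l) ENNReal.toReal_nonneg]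
    refine Finset.sum_congr rfl fun l _ => ?_
    rw [ENNReal.ofReal_mul (hp l), ENNReal.ofReal_toReal (hv l).ne]
  refine ⟨p, ω, hp, hp1, fun l => (hω l).1, fun j => ?_, ?_⟩
  · rw [hconv _ fun l => (hω l).2.1 j, hpu j,
      integral_toReal (hu j) (ae_lt_top' (hu j) (hui j)), ENNReal.ofReal_toReal (hui j)]
  · rw [hconv _ fun l => (hω l).2.2, ← ENNReal.ofReal_toReal hGi,
      ← integral_toReal hG (ae_lt_top' hG hGi)]
    exact ENNReal.ofReal_le_ofReal hpG

/-! ### Replacing an antitone function on an interval by one with three values -/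

/-- The layer cake formula for a function with values in `[0, d]`. -/
theorem lintegral_eq_lintegral_Ioo_meas_lt {Ω : Type*} [MeasurableSpace Ω] (κ : Measure Ω)
    {f : Ω → ℝ} {d : ℝ} (hf : AEMeasurable f κ) (h0 : ∀ᵐ x ∂κ, 0 ≤ f x) (hd : ∀ᵐ x ∂κ, f x ≤ d) :
    ∫⁻ x, ENNReal.ofReal (f x) ∂κ = ∫⁻ t in Ioo 0 d, κ {x | t < f x} := by
  rw [lintegral_eq_lintegral_meas_lt κ h0 hf, ← lintegral_indicator measurableSet_Ioi,
    ← lintegral_indicator measurableSet_Ioo]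
  refine lintegral_congr_ae ?_
  have hne : ∀ᵐ t : ℝ, t ≠ d := by simp [ae_iff]
  filter_upwards [hne] with t ht
  rcases le_or_gt t 0 with h | h
  · rw [indicator_of_notMem (by simpa using h), indicator_of_notMem (fun h' => h.not_gt h'.1)]
  · rw [indicator_of_mem (by simpa using h)]
    rcases lt_or_gt_of_ne ht with h1 | h1
    · rw [indicator_of_mem (show t ∈ Ioo 0 d from ⟨h, h1⟩)]
    · rw [indicator_of_notMem (fun h' => h1.not_gt h'.2)]
      exact measure_mono_null (fun x hx => (not_le.2 (h1.trans hx) : ¬ f x ≤ d)) hd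

/-- The average of `d • 1{t < f}` over two levels `t` with weights `p`. -/
noncomputable def twoLevel {Ω : Type*} (f : Ω → ℝ) (d : ℝ) (p t : Fin 2 → ℝ) (x : Ω) : ℝ :=
  d * ∑ l, p l * (if t l < f x then 1 else 0)

theorem twoLevel_nonneg {Ω : Type*} (f : Ω → ℝ) {d : ℝ} {p t : Fin 2 → ℝ} (hd : 0 ≤ d)
    (hp : ∀ l, 0 ≤ p l) (x : Ω) : 0 ≤ twoLevel f d p t x :=
  mul_nonneg hd (Finset.sum_nonneg fun l _ => mul_nonneg (hp l) (by split_ifs <;> simp))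

theorem twoLevel_le {Ω : Type*} (f : Ω → ℝ) {d : ℝ} {p t : Fin 2 → ℝ} (hd : 0 ≤ d)
    (hp : ∀ l, 0 ≤ p l) (hp1 : ∑ l, p l = 1) (x : Ω) : twoLevel f d p t x ≤ d := by
  have : ∑ l, p l * (if t l < f x then (1 : ℝ) else 0) ≤ ∑ l, p l :=
    Finset.sum_le_sum fun l _ => by
      have := hp l
      split_ifs <;> simp [this]
  calc twoLevel f d p t x ≤ d * 1 := mul_le_mul_of_nonneg_left (this.trans_eq hp1) hd
    _ = d := mul_one d

theorem twoLevel_mono {Ω : Type*} (f : Ω → ℝ) {d : ℝ} {p t : Fin 2 → ℝ} (hd : 0 ≤ d)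
    (hp : ∀ l, 0 ≤ p l) {x y : Ω} (hxy : f x ≤ f y) : twoLevel f d p t x ≤ twoLevel f d p t y := by
  refine mul_le_mul_of_nonneg_left (Finset.sum_le_sum fun l _ =>
    mul_le_mul_of_nonneg_left ?_ (hp l)) hd
  by_cases h : t l < f x
  · simp [h, h.trans_le hxy]
  · split_ifs <;> simp

theorem lintegral_twoLevel {Ω : Type*} [MeasurableSpace Ω] (κ : Measure Ω) {f : Ω → ℝ} {d : ℝ}
    {p t : Fin 2 → ℝ} (hf : AEMeasurable f κ) (hd : 0 ≤ d) (hp : ∀ l, 0 ≤ p l) :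
    ∫⁻ x, ENNReal.ofReal (twoLevel f d p t x) ∂κ =
      ENNReal.ofReal d * ∑ l, ENNReal.ofReal (p l) * κ {x | t l < f x} := by
  have hms : ∀ l, NullMeasurableSet {x | t l < f x} κ := fun l =>
    nullMeasurableSet_lt aemeasurable_const hf
  have hpt : ∀ x, ENNReal.ofReal (twoLevel f d p t x) = ENNReal.ofReal d *
      ∑ l, ENNReal.ofReal (p l) * {x | t l < f x}.indicator 1 x := by
    intro x
    rw [twoLevel, ENNReal.ofReal_mul hd, ENNReal.ofReal_sum_of_nonneg fun l _ =>
      mul_nonneg (hp l) (by split_ifs <;> simp)]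
    congr 1
    refine Finset.sum_congr rfl fun l _ => ?_
    rw [ENNReal.ofReal_mul (hp l)]
    by_cases h : t l < f x <;> simp [h]
  simp_rw [hpt]
  have hm : ∀ l, AEMeasurable ({x | t l < f x}.indicator (1 : Ω → ℝ≥0∞)) κ := fun l =>
    (aemeasurable_indicator_const_iff (1 : ℝ≥0∞)).2 (hms l)
  rw [lintegral_const_mul'' _ (Finset.aemeasurable_fun_sum _ fun l _ => (hm l).const_mul _),
    lintegral_finsetSum' _ fun l _ => (hm l).const_mul _]
  congr 1
  refine Finset.sum_congr rfl fun l _ => ?_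
  rw [lintegral_const_mul'' _ (hm l), lintegral_indicator_one₀ (hms l)]

/-- A bounded function can be replaced by a function `twoLevel` with the same integral, such that
the integral over a given set does not decrease. -/
theorem exists_twoLevel {Ω : Type*} [MeasurableSpace Ω] (ν : Measure Ω) [IsFiniteMeasure ν]
    {f : Ω → ℝ} {d : ℝ} (hd : 0 < d) (hf : AEMeasurable f ν) (h0 : ∀ᵐ x ∂ν, 0 ≤ f x)
    (hfd : ∀ᵐ x ∂ν, f x ≤ d) (q : Set Ω) :
    ∃ p t : Fin 2 → ℝ, (∀ l, 0 ≤ p l) ∧ ∑ l, p l = 1 ∧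
      ∫⁻ x, ENNReal.ofReal (twoLevel f d p t x) ∂ν = ∫⁻ x, ENNReal.ofReal (f x) ∂ν ∧
      ∫⁻ x in q, ENNReal.ofReal (f x) ∂ν ≤ ∫⁻ x in q, ENNReal.ofReal (twoLevel f d p t x) ∂ν := by
  have hd0 : ENNReal.ofReal d ≠ 0 := by simpa using hd
  -- The level `t` is made uniform on `(0, d)`: by the layer cake formula, `f` is the mean of `d •
  -- 1{t < f}`.
  let μ : Measure ℝ := (ENNReal.ofReal d)⁻¹ • volume.restrict (Ioo 0 d)
  have hμ : IsProbabilityMeasure μ := ⟨by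
    simp only [μ, Measure.smul_apply, Measure.restrict_apply_univ, Real.volume_Ioo, sub_zero,
      smul_eq_mul]
    exact ENNReal.inv_mul_cancel hd0 ENNReal.ofReal_ne_top⟩
  have hmeas : ∀ κ : Measure Ω, Measurable fun t : ℝ => κ {x | t < f x} := fun κ =>
    Antitone.measurable fun s t hst => measure_mono fun x (hx : t < f x) => hst.trans_lt hx
  have hfinite : ∀ κ : Measure Ω, IsFiniteMeasure κ → ∫⁻ t, κ {x | t < f x} ∂μ ≠ ∞ := by
    intro κ _
    refine ne_top_of_le_ne_top (measure_ne_top κ univ) ?_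
    calc ∫⁻ t, κ {x | t < f x} ∂μ ≤ ∫⁻ _, κ univ ∂μ :=
          lintegral_mono fun t => measure_mono (subset_univ _)
      _ = κ univ := by simp
  -- One fixed moment, the total integral, therefore two levels; the integral over `q` is the
  -- quantity that must not decrease.
  obtain ⟨p, t, hp, hp1, -, hu, hG⟩ := exists_discrete_of_lintegral (m := 1) μ
    (fun _ t => ν {x | t < f x}) (fun t => (ν.restrict q) {x | t < f x})
    (fun _ => (hmeas _).aemeasurable) (hmeas _).aemeasurable (fun _ => hfinite _ inferInstance)
    (hfinite _ inferInstance) (S := univ) (by simp)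
  have hlc : ∀ κ : Measure Ω, κ ≤ ν → ∫⁻ x, ENNReal.ofReal (f x) ∂κ =
      ENNReal.ofReal d * ∫⁻ t, κ {x | t < f x} ∂μ := by
    intro κ hκ
    rw [lintegral_eq_lintegral_Ioo_meas_lt κ (hf.mono_measure hκ) (ae_mono hκ h0) (ae_mono hκ hfd),
      lintegral_smul_measure, smul_eq_mul, ← mul_assoc,
      ENNReal.mul_inv_cancel hd0 ENNReal.ofReal_ne_top, one_mul]
  refine ⟨p, t, hp, hp1, ?_, ?_⟩
  · rw [lintegral_twoLevel ν hf hd.le hp, hlc ν le_rfl]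
    exact congrArg _ (hu 0)
  · rw [lintegral_twoLevel _ hf.restrict hd.le hp, hlc _ Measure.restrict_le_self]
    gcongr

/-- `B` contains all the places where the function `h` changes on `(a, b)`. -/
def IsStepOn (B : Finset ℝ) (h : ℝ → ℝ) (a b : ℝ) : Prop :=
  ∀ x ∈ Ioo a b, ∀ y ∈ Ioo a b, x ≤ y → (∀ c ∈ B, c ∉ Icc x y) → h x = h y

/-- This is the tangent inequality `(v - w)₊ ≥ (u - w) + (v - u)` at a point `u ≥ w`. The reference
value `r` is added so that no subtraction in `[0, ∞]` occurs. -/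
theorem toENNReal_sub_add_ofReal_le {u v r : ℝ} {w : EReal} (hw : w ≤ u) (hv : r ≤ v) :
    ((u : EReal) - w).toENNReal + ENNReal.ofReal (v - r) ≤
      ((v : EReal) - w).toENNReal + ENNReal.ofReal (u - r) := by
  induction w with
  | bot => simp
  | top => simp at hw
  | coe w =>
    have hw' : w ≤ u := by exact_mod_cast hw
    rw [← EReal.coe_sub, ← EReal.coe_sub, EReal.toENNReal_of_ne_top (EReal.coe_ne_top _),
      EReal.toENNReal_of_ne_top (EReal.coe_ne_top _), EReal.toReal_coe, EReal.toReal_coe,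
      ← ENNReal.ofReal_add (by linarith) (by linarith)]
    calc ENNReal.ofReal (u - w + (v - r)) = ENNReal.ofReal ((v - w) + (u - r)) := by
          congr 1; ring
      _ ≤ _ := ENNReal.ofReal_add_le

/-- On one interval, an antitone function can be replaced by an antitone function with two jumps,
the same range and the same integral, for which the integral of `(h - g)₊` is not smaller. -/
theorem exists_step_of_antitoneOn {a b : ℝ} {h : ℝ → ℝ} {g : ℝ → EReal} (hab : a < b)
    (hh : AntitoneOn h (Ioo a b)) (hbelow : BddBelow (h '' Ioo a b))
    (habove : BddAbove (h '' Ioo a b)) (hg : AEMeasurable g (volume.restrict (Ioo a b))) :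
    ∃ (h' : ℝ → ℝ) (B : Finset ℝ), B.card ≤ 2 ∧ AntitoneOn h' (Ioo a b) ∧
      (∀ M, (∀ x ∈ Ioo a b, h x ≤ M) → ∀ x ∈ Ioo a b, h' x ≤ M) ∧
      (∀ m, (∀ x ∈ Ioo a b, m ≤ h x) → ∀ x ∈ Ioo a b, m ≤ h' x) ∧ IsStepOn B h' a b ∧
      (∀ r, (∀ x ∈ Ioo a b, r ≤ h x) → ∫⁻ x in Ioo a b, ENNReal.ofReal (h' x - r) =
        ∫⁻ x in Ioo a b, ENNReal.ofReal (h x - r)) ∧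
      ∫⁻ x in Ioo a b, ((h x : EReal) - g x).toENNReal ≤
        ∫⁻ x in Ioo a b, ((h' x : EReal) - g x).toENNReal := by
  have hne : (h '' Ioo a b).Nonempty := (nonempty_Ioo.2 hab).image h
  set lo := sInf (h '' Ioo a b)
  set hi := sSup (h '' Ioo a b)
  have hlo : ∀ x ∈ Ioo a b, lo ≤ h x := fun x hx => csInf_le hbelow (mem_image_of_mem h hx)
  have hhi : ∀ x ∈ Ioo a b, h x ≤ hi := fun x hx => le_csSup habove (mem_image_of_mem h hx)
  have hlohi : lo ≤ hi := csInf_le_csSup hne hbelow habove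
  have hlo' : ∀ m, (∀ x ∈ Ioo a b, m ≤ h x) → m ≤ lo := fun m hm =>
    le_csInf hne (by rintro _ ⟨x, hx, rfl⟩; exact hm x hx)
  have hhi' : ∀ M, (∀ x ∈ Ioo a b, h x ≤ M) → hi ≤ M := fun M hM =>
    csSup_le hne (by rintro _ ⟨x, hx, rfl⟩; exact hM x hx)
  clear_value lo hi
  rcases hlohi.eq_or_lt with heq | hlt
  · refine ⟨h, ∅, by simp, hh, fun M hM => hM, fun m hm => hm, ?_, fun r _ => rfl, le_rfl⟩
    intro x hx y hy _ _
    linarith [hlo x hx, hlo y hy, hhi x hx, hhi y hy]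
  set ν := volume.restrict (Ioo a b)
  have hhm : AEMeasurable h ν := aemeasurable_restrict_of_antitoneOn measurableSet_Ioo hh
  have hmem : ∀ᵐ x ∂ν, x ∈ Ioo a b := ae_restrict_mem measurableSet_Ioo
  have hd : 0 < hi - lo := sub_pos.2 hlt
  -- On `{g ≤ h}` the integrand `(h - g)₊` is `h - g`, so its slope in `h` is one there; elsewhere
  -- it vanishes and cannot get smaller.
  obtain ⟨p, t, hp, hp1, heq, hle⟩ := exists_twoLevel ν (f := fun x => h x - lo) hd
    (hhm.sub_const _) (by filter_upwards [hmem] with x hx using sub_nonneg.2 (hlo x hx))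
    (by filter_upwards [hmem] with x hx using sub_le_sub_right (hhi x hx) _) {x | g x ≤ h x}
  set k := twoLevel (fun x => h x - lo) (hi - lo) p t with hk
  have hk0 : ∀ x, 0 ≤ k x := twoLevel_nonneg _ hd.le hp
  have hkd : ∀ x, k x ≤ hi - lo := twoLevel_le _ hd.le hp hp1
  have hanti : AntitoneOn k (Ioo a b) := fun x hx y hy hxy =>
    twoLevel_mono _ hd.le hp (sub_le_sub_right (hh hx hy hxy) _)
  -- Each set `{t l < h - lo}` is an initial segment of the interval, so its indicator can jump only
  -- at its supremum. If the set is empty, the junk value of `sSup` is a harmless extra point.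
  refine ⟨fun x => lo + k x,
    Finset.univ.image fun l => sSup {x | x ∈ Ioo a b ∧ t l < h x - lo}, ?_, ?_, ?_, ?_, ?_, ?_, ?_⟩
  · exact Finset.card_image_le.trans (by simp)
  · exact fun x hx y hy hxy => add_le_add_right (hanti hx hy hxy) _
  · intro M hM x _
    linarith [hkd x, hhi' M hM]
  · intro m hm x _
    linarith [hk0 x, hlo' m hm]
  · intro x hx y hy hxy hB
    simp only [hk, twoLevel]
    congr 2
    refine Finset.sum_congr rfl fun l _ => ?_
    congr 1
    by_cases hty : t l < h y - lo
    · have htx : t l < h x - lo := hty.trans_le (sub_le_sub_right (hh hx hy hxy) _)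
      simp [hty, htx]
    · have htx : ¬ t l < h x - lo := by
        intro htx
        refine hB _ (Finset.mem_image_of_mem _ (Finset.mem_univ l)) ⟨?_, ?_⟩
        · exact le_csSup ⟨b, fun z hz => hz.1.2.le⟩ ⟨hx, htx⟩
        · refine csSup_le ⟨x, hx, htx⟩ fun z hz => ?_
          by_contra hyz
          exact hty (hz.2.trans_le (sub_le_sub_right (hh hy hz.1 (not_le.1 hyz).le) _))
      simp [hty, htx]
  · intro r hr
    have hrlo := hlo' r hr
    have hsplit : ∀ v : ℝ, lo ≤ v → ENNReal.ofReal (v - r) =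
        ENNReal.ofReal (v - lo) + ENNReal.ofReal (lo - r) := fun v hv => by
      rw [← ENNReal.ofReal_add (by linarith) (by linarith)]
      congr 1; ring
    calc ∫⁻ x, ENNReal.ofReal (lo + k x - r) ∂ν
        = ∫⁻ x, (ENNReal.ofReal (k x) + ENNReal.ofReal (lo - r)) ∂ν := by
          refine lintegral_congr fun x => ?_
          rw [hsplit _ (by linarith [hk0 x]), add_sub_cancel_left]
      _ = ∫⁻ x, (ENNReal.ofReal (h x - lo) + ENNReal.ofReal (lo - r)) ∂ν := by
          rw [lintegral_add_right _ measurable_const, lintegral_add_right _ measurable_const, heq]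
      _ = ∫⁻ x, ENNReal.ofReal (h x - r) ∂ν := by
          refine lintegral_congr_ae ?_
          filter_upwards [hmem] with x hx
          rw [hsplit _ (hlo x hx)]
  · have hq : NullMeasurableSet {x | g x ≤ h x} ν :=
      nullMeasurableSet_le hg hhm.coe_real_ereal
    have hkm : AEMeasurable k ν := aemeasurable_restrict_of_antitoneOn measurableSet_Ioo hanti
    -- Finiteness allows this term to be cancelled after the tangent inequality has been integrated.
    have hfin : ∫⁻ x in {x | g x ≤ h x}, ENNReal.ofReal (k x) ∂ν ≠ ∞ := by
      refine ne_top_of_le_ne_top (b := ∫⁻ x, ENNReal.ofReal (hi - lo) ∂ν) ?_ ?_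
      · simp [ν, ENNReal.mul_eq_top]
      · refine (setLIntegral_le_lintegral _ _).trans (lintegral_mono fun x => ?_)
        exact ENNReal.ofReal_le_ofReal (hkd x)
    have h1 : ∫⁻ x, ((h x : EReal) - g x).toENNReal ∂ν =
        ∫⁻ x in {x | g x ≤ h x}, ((h x : EReal) - g x).toENNReal ∂ν := by
      rw [← lintegral_indicator₀ hq]
      refine lintegral_congr fun x => ?_
      by_cases hx : g x ≤ h x
      · rw [indicator_of_mem (show x ∈ {x | g x ≤ h x} from hx)]
      · rw [indicator_of_notMem (show x ∉ {x | g x ≤ h x} from hx)]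
        refine EReal.toENNReal_of_nonpos (EReal.sub_nonpos.2 (not_le.1 hx).le)
    have h2 : ∫⁻ x in {x | g x ≤ h x}, ((h x : EReal) - g x).toENNReal ∂ν +
        ∫⁻ x in {x | g x ≤ h x}, ENNReal.ofReal (k x) ∂ν ≤
        ∫⁻ x in {x | g x ≤ h x}, ((↑(lo + k x) : EReal) - g x).toENNReal ∂ν +
        ∫⁻ x in {x | g x ≤ h x}, ENNReal.ofReal (h x - lo) ∂ν := by
      rw [← lintegral_add_right' _ hkm.ennreal_ofReal.restrict,
        ← lintegral_add_right' _ (hhm.sub_const lo).ennreal_ofReal.restrict]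
      refine lintegral_mono_ae ?_
      filter_upwards [ae_restrict_mem₀ hq] with x hx
      have := toENNReal_sub_add_ofReal_le (u := h x) (v := lo + k x) (r := lo) hx
        (by linarith [hk0 x])
      rwa [add_sub_cancel_left] at this
    rw [h1]
    refine le_trans ?_ (setLIntegral_le_lintegral {x | g x ≤ h x} _)
    refine (ENNReal.add_le_add_iff_right hfin).1 (h2.trans ?_)
    gcongr

/-! ### Cutting the upper boundary at the crossings with the boxes -/

namespace OUDRO

/-- The length of the vertical segment from the bottom of the tail region up to height `v`. -/
noncomputable def Data.areaFun {n : ℕ} (D : Data n) (v : ℝ) : ℝ≥0∞ := ENNReal.ofReal (v - D.y0)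

/-- The length of the part in the `k`-th box of the vertical segment at `x` up to height `v`. -/
noncomputable def Data.boxFun {n : ℕ} (D : Data n) (k : Fin n) (x v : ℝ) : ℝ≥0∞ :=
  {x : ℝ | D.x1 k ≤ x ∧ (x : EReal) ≤ D.x2 k}.indicator
    (fun _ => (min (v : EReal) (D.y2 k) - min (v : EReal) ((D.y1 k : ℝ) : EReal)).toENNReal) x

/-- The length of the part in the rare event of the vertical segment at `x` up to height `v`. -/
noncomputable def Data.objFun {n : ℕ} (D : Data n) (x v : ℝ) : ℝ≥0∞ := ((v : EReal) - D.g x).toENNReal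

/-- On `(a, b)` the function `h` can be replaced by an antitone function with the same range and
fewer than `3 m` jumps, without changing the area and the areas in the boxes, and without decreasing
the area in the rare event. -/
def Data.Replaceable {n : ℕ} (D : Data n) (h : ℝ → ℝ) (m : ℕ) (a b : ℝ) : Prop :=
  ∃ (h' : ℝ → ℝ) (B : Finset ℝ), B.card + 1 ≤ 3 * m ∧ AntitoneOn h' (Ioo a b) ∧
    (∀ M, (∀ x ∈ Ioo a b, h x ≤ M) → ∀ x ∈ Ioo a b, h' x ≤ M) ∧
    (∀ m, (∀ x ∈ Ioo a b, m ≤ h x) → ∀ x ∈ Ioo a b, m ≤ h' x) ∧ IsStepOn B h' a b ∧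
    ∫⁻ x in Ioo a b, D.areaFun (h' x) = ∫⁻ x in Ioo a b, D.areaFun (h x) ∧
    (∀ k, ∫⁻ x in Ioo a b, D.boxFun k x (h' x) = ∫⁻ x in Ioo a b, D.boxFun k x (h x)) ∧
    ∫⁻ x in Ioo a b, D.objFun x (h x) ≤ ∫⁻ x in Ioo a b, D.objFun x (h' x)

theorem setLIntegral_Ioo_add {a b c : ℝ} (hac : a < c) (hcb : c < b) (f : ℝ → ℝ≥0∞) :
    ∫⁻ x in Ioo a b, f x = (∫⁻ x in Ioo a c, f x) + ∫⁻ x in Ioo c b, f x := by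
  rw [← Ioc_union_Ioo_eq_Ioo hac.le hcb,
    lintegral_union measurableSet_Ioo (by
      rw [Set.disjoint_left]; intro x hx hx'; exact hx.2.not_gt hx'.1),
    setLIntegral_congr (s := Ioc a c) Ioo_ae_eq_Ioc.symm]

/-- Replacement does not enlarge the range, so the left piece stays above `h c` and the right one
below it, and the glued function is antitone. The cut is one more possible jump: `(3 m₁ - 1) + (3 m₂
- 1) + 1 = 3 (m₁ + m₂) - 1`. -/
theorem Data.Replaceable.union {n : ℕ} {D : Data n} {h : ℝ → ℝ} {m₁ m₂ : ℕ} {a b c : ℝ}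
    (hac : a < c) (hcb : c < b) (hh : AntitoneOn h (Ioo a b)) (h₁ : D.Replaceable h m₁ a c)
    (h₂ : D.Replaceable h m₂ c b) : D.Replaceable h (m₁ + m₂) a b := by
  obtain ⟨f₁, B₁, hB₁, ha₁, hM₁, hm₁, hs₁, hA₁, hk₁, ho₁⟩ := h₁
  obtain ⟨f₂, B₂, hB₂, ha₂, hM₂, hm₂, hs₂, hA₂, hk₂, ho₂⟩ := h₂
  have hc : c ∈ Ioo a b := ⟨hac, hcb⟩
  have hsub₁ : Ioo a c ⊆ Ioo a b := Ioo_subset_Ioo_right hcb.le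
  have hsub₂ : Ioo c b ⊆ Ioo a b := Ioo_subset_Ioo_left hac.le
  have hge : ∀ x ∈ Ioo a c, h c ≤ f₁ x := hm₁ _ fun x hx => hh (hsub₁ hx) hc hx.2.le
  have hle : ∀ x ∈ Ioo c b, f₂ x ≤ h c := hM₂ _ fun x hx => hh hc (hsub₂ hx) hx.1.le
  set f : ℝ → ℝ := fun x => if x < c then f₁ x else if x = c then h c else f₂ x with hf
  have hf₁ : ∀ x, x < c → f x = f₁ x := fun x hx => by simp [hf, hx]
  have hfc : f c = h c := by simp [hf]
  have hf₂ : ∀ x, c < x → f x = f₂ x := fun x hx => by simp [hf, hx.not_gt, hx.ne']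
  have htr : ∀ F : ℝ → ℝ → ℝ≥0∞, ∫⁻ x in Ioo a b, F x (f x) =
      (∫⁻ x in Ioo a c, F x (f₁ x)) + ∫⁻ x in Ioo c b, F x (f₂ x) := fun F => by
    rw [setLIntegral_Ioo_add hac hcb]
    congr 1
    · exact setLIntegral_congr_fun measurableSet_Ioo fun x hx => by simp only [hf₁ x hx.2]
    · exact setLIntegral_congr_fun measurableSet_Ioo fun x hx => by simp only [hf₂ x hx.1]
  refine ⟨f, insert c (B₁ ∪ B₂), ?_, ?_, ?_, ?_, ?_, ?_, fun k => ?_, ?_⟩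
  · have := Finset.card_insert_le c (B₁ ∪ B₂)
    have := Finset.card_union_le B₁ B₂
    omega
  · intro x hx y hy hxy
    rcases lt_trichotomy x c with hxc | hxc | hxc <;> rcases lt_trichotomy y c with hyc | hyc | hyc
    · rw [hf₁ x hxc, hf₁ y hyc]
      exact ha₁ ⟨hx.1, hxc⟩ ⟨hy.1, hyc⟩ hxy
    · rw [hf₁ x hxc, hyc, hfc]
      exact hge x ⟨hx.1, hxc⟩
    · rw [hf₁ x hxc, hf₂ y hyc]
      exact (hle y ⟨hyc, hy.2⟩).trans (hge x ⟨hx.1, hxc⟩)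
    · exact absurd (hxc ▸ hxy) hyc.not_ge
    · rw [hyc, hxc]
    · rw [hxc, hfc, hf₂ y hyc]
      exact hle y ⟨hyc, hy.2⟩
    · exact absurd (hxc.trans_le hxy) hyc.not_gt
    · exact absurd (hxc.trans_le hxy) hyc.not_gt
    · rw [hf₂ x hxc, hf₂ y hyc]
      exact ha₂ ⟨hxc, hx.2⟩ ⟨hyc, hy.2⟩ hxy
  · intro M hM x hx
    rcases lt_trichotomy x c with hxc | rfl | hxc
    · rw [hf₁ x hxc]
      exact hM₁ M (fun y hy => hM y (hsub₁ hy)) x ⟨hx.1, hxc⟩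
    · rw [hfc]
      exact hM x hc
    · rw [hf₂ x hxc]
      exact hM₂ M (fun y hy => hM y (hsub₂ hy)) x ⟨hxc, hx.2⟩
  · intro M hM x hx
    rcases lt_trichotomy x c with hxc | rfl | hxc
    · rw [hf₁ x hxc]
      exact hm₁ M (fun y hy => hM y (hsub₁ hy)) x ⟨hx.1, hxc⟩
    · rw [hfc]
      exact hM x hc
    · rw [hf₂ x hxc]
      exact hm₂ M (fun y hy => hM y (hsub₂ hy)) x ⟨hxc, hx.2⟩
  · intro x hx y hy hxy hB
    simp only [Finset.mem_insert, Finset.mem_union, forall_eq_or_imp] at hB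
    rcases lt_trichotomy y c with hyc | hyc | hyc
    · have hxc := hxy.trans_lt hyc
      rw [hf₁ x hxc, hf₁ y hyc]
      exact hs₁ x ⟨hx.1, hxc⟩ y ⟨hy.1, hyc⟩ hxy fun d hd => hB.2 d (Or.inl hd)
    · exact absurd (show c ∈ Icc x y from ⟨hyc ▸ hxy, hyc.ge⟩) hB.1
    · have hxc : c < x := by
        by_contra hcon
        exact hB.1 ⟨not_lt.1 hcon, hyc.le⟩
      rw [hf₂ x hxc, hf₂ y hyc]
      exact hs₂ x ⟨hxc, hx.2⟩ y ⟨hyc, hy.2⟩ hxy fun d hd => hB.2 d (Or.inr hd)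
  · rw [htr fun _ v => D.areaFun v, hA₁, hA₂, ← setLIntegral_Ioo_add hac hcb]
  · rw [htr (D.boxFun k), hk₁, hk₂, ← setLIntegral_Ioo_add hac hcb]
  · rw [htr D.objFun, setLIntegral_Ioo_add hac hcb]
    exact add_le_add ho₁ ho₂

/-- On `(a, b)` neither the abscissa nor the function `h` crosses a side of a box. -/
def Data.Uncrossed {n : ℕ} (D : Data n) (h : ℝ → ℝ) (a b : ℝ) : Prop :=
  ∀ k, ((∀ x ∈ Ioo a b, D.x1 k ≤ x) ∨ ∀ x ∈ Ioo a b, x < D.x1 k) ∧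
    ((∀ x ∈ Ioo a b, (x : EReal) ≤ D.x2 k) ∨ ∀ x ∈ Ioo a b, D.x2 k < x) ∧
    ((∀ x ∈ Ioo a b, D.y1 k ≤ h x) ∨ ∀ x ∈ Ioo a b, h x ≤ D.y1 k) ∧
    ((∀ x ∈ Ioo a b, (h x : EReal) ≤ D.y2 k) ∨ ∀ x ∈ Ioo a b, D.y2 k ≤ h x)

/-- Without crossings, the length in a box is `0` (abscissa outside, or `h` below the box), `h - y1`
(`h` inside) or independent of `h` (`h` above). Keeping the integral of `h` and its bounds therefore
keeps all box areas at once, however many boxes there are. -/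
theorem Data.Uncrossed.replaceable {n : ℕ} {D : Data n} {h : ℝ → ℝ} {a b : ℝ}
    (hU : D.Uncrossed h a b) (hab : a < b) (hh : AntitoneOn h (Ioo a b))
    (hy0 : ∀ x ∈ Ioo a b, D.y0 ≤ h x) (habove : BddAbove (h '' Ioo a b))
    (hg : AEMeasurable D.g (volume.restrict (Ioo a b))) (hy : ∀ k, (D.y1 k : EReal) ≤ D.y2 k) :
    D.Replaceable h 1 a b := by
  obtain ⟨h', B, hB, hanti, hM, hm, hs, hI, ho⟩ := exists_step_of_antitoneOn hab hh
    ⟨D.y0, by rintro _ ⟨x, hx, rfl⟩; exact hy0 x hx⟩ habove hg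
  obtain ⟨x₀, hx₀⟩ := nonempty_Ioo.2 hab
  refine ⟨h', B, by omega, hanti, hM, hm, hs, hI _ hy0, fun k => ?_, ho⟩
  obtain ⟨hx1, hx2, hy1, hy2⟩ := hU k
  have hz : (∀ x ∈ Ioo a b, x ∉ {x : ℝ | D.x1 k ≤ x ∧ (x : EReal) ≤ D.x2 k}) →
      ∫⁻ x in Ioo a b, D.boxFun k x (h' x) = ∫⁻ x in Ioo a b, D.boxFun k x (h x) := by
    intro hout
    refine setLIntegral_congr_fun measurableSet_Ioo fun x hx => ?_
    simp only [Data.boxFun, indicator_of_notMem (hout x hx)]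
  rcases hx1 with hx1 | hx1
  swap
  · exact hz fun x hx hx' => (hx1 x hx).not_ge hx'.1
  rcases hx2 with hx2 | hx2
  swap
  · exact hz fun x hx hx' => (hx2 x hx).not_ge hx'.2
  have hin : ∀ x ∈ Ioo a b, ∀ v, D.boxFun k x v =
      (min (v : EReal) (D.y2 k) - min (v : EReal) ((D.y1 k : ℝ) : EReal)).toENNReal :=
    fun x hx v => indicator_of_mem (show x ∈ {x : ℝ | D.x1 k ≤ x ∧ (x : EReal) ≤ D.x2 k} from
      ⟨hx1 x hx, hx2 x hx⟩) _
  rcases hy1 with hy1 | hy1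
  swap
  · have hzero : ∀ x ∈ Ioo a b, ∀ v, v ≤ D.y1 k → D.boxFun k x v = 0 := fun x hx v hv => by
      have hv1 : (v : EReal) ≤ ((D.y1 k : ℝ) : EReal) := by exact_mod_cast hv
      rw [hin x hx, min_eq_left hv1, min_eq_left (hv1.trans (hy k))]
      exact EReal.toENNReal_of_nonpos (EReal.sub_self_le_zero)
    refine setLIntegral_congr_fun measurableSet_Ioo fun x hx => ?_
    simp only [hzero x hx _ (hy1 x hx), hzero x hx _ (hM _ hy1 x hx)]
  have hy1' := hm _ hy1
  have hmin : ∀ x ∈ Ioo a b, ∀ v, D.y1 k ≤ v → D.boxFun k x v =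
      (min (v : EReal) (D.y2 k) - ((D.y1 k : ℝ) : EReal)).toENNReal := fun x hx v hv => by
    rw [hin x hx, min_eq_right (b := ((D.y1 k : ℝ) : EReal)) (by exact_mod_cast hv)]
  rcases hy2 with hy2 | hy2
  · have hy2' : ∀ x ∈ Ioo a b, (h' x : EReal) ≤ D.y2 k := by
      generalize D.y2 k = e at hy2
      induction e with
      | bot => exact absurd (hy2 x₀ hx₀) (by simp)
      | top => simp
      | coe e =>
        intro x hx
        exact_mod_cast hM e (fun z hz => by exact_mod_cast hy2 z hz) x hx
    have hlin : ∀ x ∈ Ioo a b, ∀ v, D.y1 k ≤ v → (v : EReal) ≤ D.y2 k → D.boxFun k x v =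
        ENNReal.ofReal (v - D.y1 k) := fun x hx v hv1 hv2 => by
      rw [hmin x hx v hv1, min_eq_left hv2, ← EReal.coe_sub,
        EReal.toENNReal_of_ne_top (EReal.coe_ne_top _), EReal.toReal_coe]
    rw [setLIntegral_congr_fun measurableSet_Ioo fun x hx =>
        hlin x hx _ (hy1' x hx) (hy2' x hx),
      setLIntegral_congr_fun measurableSet_Ioo fun x hx => hlin x hx _ (hy1 x hx) (hy2 x hx),
      hI _ hy1]
  · have hy2' : ∀ x ∈ Ioo a b, D.y2 k ≤ h' x := by
      generalize D.y2 k = e at hy2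
      induction e with
      | bot => simp
      | top => exact absurd (hy2 x₀ hx₀) (by simp)
      | coe e =>
        intro x hx
        exact_mod_cast hm e (fun z hz => by exact_mod_cast hy2 z hz) x hx
    refine setLIntegral_congr_fun measurableSet_Ioo fun x hx => ?_
    simp only [hmin x hx _ (hy1 x hx), hmin x hx _ (hy1' x hx), min_eq_right (hy2 x hx),
      min_eq_right (hy2' x hx)]

/-- If `C` contains all crossings on `(a, b)`, the function can be replaced by one with
`3 * C.card + 2` jumps. -/
theorem Data.replaceable_of_cuts {n : ℕ} {D : Data n} {h : ℝ → ℝ}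
    (hy : ∀ k, (D.y1 k : EReal) ≤ D.y2 k) (m : ℕ) : ∀ (C : Finset ℝ) (a b : ℝ), C.card ≤ m →
    a < b → AntitoneOn h (Ioo a b) → (∀ x ∈ Ioo a b, D.y0 ≤ h x) → BddAbove (h '' Ioo a b) →
    AEMeasurable D.g (volume.restrict (Ioo a b)) →
    (∀ a' b', a ≤ a' → b' ≤ b → a' < b' → (∀ c ∈ C, c ∉ Ioo a' b') → D.Uncrossed h a' b') →
    ∃ m' ≤ m + 1, D.Replaceable h m' a b := by
  induction m using Nat.strong_induction_on with
  | _ m ih =>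
    intro C a b hC hab hh hy0 habove hg hU
    by_cases hcut : ∃ c ∈ C, c ∈ Ioo a b
    · obtain ⟨c, hcC, hac, hcb⟩ := hcut
      have hsub₁ : Ioo a c ⊆ Ioo a b := Ioo_subset_Ioo_right hcb.le
      have hsub₂ : Ioo c b ⊆ Ioo a b := Ioo_subset_Ioo_left hac.le
      set C₁ := C.filter (· < c)
      set C₂ := C.filter (c < ·)
      -- The cut `c` belongs to neither half; this leaves room for the additional piece it creates.
      have hcard : C₁.card + C₂.card + 1 ≤ m := by
        have hd : Disjoint C₁ C₂ := by
          rw [Finset.disjoint_left]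
          intro x hx hx'
          exact (Finset.mem_filter.1 hx).2.not_gt (Finset.mem_filter.1 hx').2
        rw [← Finset.card_union_of_disjoint hd]
        refine le_trans (Finset.card_lt_card ?_) hC
        refine (Finset.ssubset_iff_of_subset ?_).2 ⟨c, hcC, by simp [C₁, C₂]⟩
        exact Finset.union_subset (Finset.filter_subset _ _) (Finset.filter_subset _ _)
      obtain ⟨m₁, hm₁, h₁⟩ := ih C₁.card (by omega) C₁ a c le_rfl hac (hh.mono hsub₁)
        (fun x hx => hy0 x (hsub₁ hx)) (habove.mono (image_mono hsub₁))
        (hg.mono_measure (Measure.restrict_mono hsub₁ le_rfl))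
        (fun a' b' ha' hb' hab' hno => hU a' b' ha' (hb'.trans hcb.le) hab' fun d hd hd' =>
          hno d (Finset.mem_filter.2 ⟨hd, hd'.2.trans_le hb'⟩) hd')
      obtain ⟨m₂, hm₂, h₂⟩ := ih C₂.card (by omega) C₂ c b le_rfl hcb (hh.mono hsub₂)
        (fun x hx => hy0 x (hsub₂ hx)) (habove.mono (image_mono hsub₂))
        (hg.mono_measure (Measure.restrict_mono hsub₂ le_rfl))
        (fun a' b' ha' hb' hab' hno => hU a' b' (hac.le.trans ha') hb' hab' fun d hd hd' =>
          hno d (Finset.mem_filter.2 ⟨hd, ha'.trans_lt hd'.1⟩) hd')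
      exact ⟨m₁ + m₂, by omega, h₁.union hac hcb hh h₂⟩
    · push Not at hcut
      exact ⟨1, by omega, (hU a b le_rfl le_rfl hab hcut).replaceable hab hh hy0 habove hg hy⟩

theorem forall_le_or_forall_lt_of_notMem_Ioo {a b c : ℝ} (hc : c ∉ Ioo a b) :
    (∀ x ∈ Ioo a b, x < c) ∨ ∀ x ∈ Ioo a b, c < x := by
  rcases le_or_gt b c with h | h
  · exact Or.inl fun x hx => hx.2.trans_le h
  · refine Or.inr fun x hx => lt_of_le_of_lt ?_ hx.1
    by_contra hcon
    exact hc ⟨not_le.1 hcon, h⟩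

/-- An antitone function crosses a level only at one place. -/
theorem forall_le_or_forall_le_of_sSup_notMem {a b a' b' : ℝ} {h : ℝ → ℝ}
    (hh : AntitoneOn h (Ioo a b)) (ha : a ≤ a') (hb : b' ≤ b) (e : EReal)
    (hc : sSup {x | x ∈ Ioo a b ∧ e ≤ h x} ∉ Ioo a' b') :
    (∀ x ∈ Ioo a' b', e ≤ h x) ∨ ∀ x ∈ Ioo a' b', (h x : EReal) < e := by
  have hsub : Ioo a' b' ⊆ Ioo a b := Ioo_subset_Ioo ha hb
  by_contra hcon
  push Not at hcon
  obtain ⟨⟨x, hx, hxe⟩, y, hy, hye⟩ := hcon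
  rcases forall_le_or_forall_lt_of_notMem_Ioo hc with h1 | h1
  · have hlt := h1 x hx
    obtain ⟨z, hz, hxz⟩ := exists_lt_of_lt_csSup
      (show {x | x ∈ Ioo a b ∧ e ≤ h x}.Nonempty from ⟨y, hsub hy, hye⟩) hlt
    refine hxe.not_ge (hz.2.trans ?_)
    exact_mod_cast hh (hsub hx) hz.1 hxz.le
  · exact (h1 y hy).not_ge (le_csSup ⟨b, fun z hz => hz.1.2.le⟩ ⟨hsub hy, hye⟩)

/-- On a bounded interval, an antitone function can be replaced by one with `12 n + 2` jumps. -/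
theorem Data.exists_replaceable {n : ℕ} {D : Data n} {h : ℝ → ℝ} {a b : ℝ}
    (hy : ∀ k, (D.y1 k : EReal) ≤ D.y2 k) (hx : ∀ k, (D.x1 k : EReal) ≤ D.x2 k) (hab : a < b)
    (hh : AntitoneOn h (Ioo a b)) (hy0 : ∀ x ∈ Ioo a b, D.y0 ≤ h x)
    (habove : BddAbove (h '' Ioo a b)) (hg : AEMeasurable D.g (volume.restrict (Ioo a b))) :
    ∃ m ≤ 4 * n + 1, D.Replaceable h m a b := by
  -- An antitone function passes each level at one place. For empty sets, and for infinite `x2`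
  -- under `toReal`, the junk value only adds a superfluous cut.
  let cr (e : EReal) : ℝ := sSup {x | x ∈ Ioo a b ∧ e ≤ h x}
  let C : Finset ℝ := (Finset.univ.image D.x1 ∪ Finset.univ.image fun k => (D.x2 k).toReal) ∪
    ((Finset.univ.image fun k => cr (D.y1 k : ℝ)) ∪ Finset.univ.image fun k => cr (D.y2 k))
  have hcard : C.card ≤ 4 * n := by
    have h1 := Finset.card_union_le (Finset.univ.image D.x1 ∪ Finset.univ.image fun k =>
      (D.x2 k).toReal) ((Finset.univ.image fun k => cr (D.y1 k : ℝ)) ∪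
      Finset.univ.image fun k => cr (D.y2 k))
    have h2 := Finset.card_union_le (Finset.univ.image D.x1) (Finset.univ.image fun k =>
      (D.x2 k).toReal)
    have h3 := Finset.card_union_le (Finset.univ.image fun k => cr (D.y1 k : ℝ))
      (Finset.univ.image fun k => cr (D.y2 k))
    have h4 : ∀ f : Fin n → ℝ, (Finset.univ.image f).card ≤ n := fun f =>
      Finset.card_image_le.trans (by simp)
    have := h4 D.x1
    have := h4 fun k => (D.x2 k).toReal
    have := h4 fun k => cr (D.y1 k : ℝ)
    have := h4 fun k => cr (D.y2 k)
    simp only [C]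
    omega
  refine Data.replaceable_of_cuts hy (4 * n) C a b hcard hab hh hy0 habove hg ?_
  intro a' b' ha hb hab' hno k
  simp only [C, Finset.mem_union, Finset.mem_image, Finset.mem_univ, true_and] at hno
  refine ⟨?_, ?_, ?_, ?_⟩
  · have := forall_le_or_forall_lt_of_notMem_Ioo (hno _ (Or.inl (Or.inl ⟨k, rfl⟩)))
    rcases this with h1 | h1
    · exact Or.inr h1
    · exact Or.inl fun x hx => (h1 x hx).le
  · have := forall_le_or_forall_lt_of_notMem_Ioo (hno _ (Or.inl (Or.inr ⟨k, rfl⟩)))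
    have hxk := hx k
    generalize D.x2 k = e at this hxk
    induction e with
    | bot => exact absurd hxk (by simp)
    | top => simp
    | coe e =>
      rcases this with h1 | h1
      · exact Or.inl fun x hx => by exact_mod_cast (h1 x hx).le
      · exact Or.inr fun x hx => by exact_mod_cast h1 x hx
  · have := forall_le_or_forall_le_of_sSup_notMem hh ha hb _ (hno _ (Or.inr (Or.inl ⟨k, rfl⟩)))
    rcases this with h1 | h1
    · exact Or.inl fun x hx => by exact_mod_cast h1 x hx
    · exact Or.inr fun x hx => by exact_mod_cast (h1 x hx).le
  · have := forall_le_or_forall_le_of_sSup_notMem hh ha hb _ (hno _ (Or.inr (Or.inr ⟨k, rfl⟩)))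
    rcases this with h1 | h1
    · exact Or.inr h1
    · exact Or.inl fun x hx => (h1 x hx).le

end OUDRO

/-! ### From antitone functions with few jumps to admissible parameters -/

/-- An interval can be partitioned into `N` intervals whose interiors miss a given set with fewer
than `N` elements. -/
theorem exists_partition_of_card_lt (B : Finset ℝ) (a : ℝ) (N : ℕ) : ∀ T, a < T →
    (B.filter (· ∈ Ioo a T)).card < N → ∃ β : ℕ → ℝ, β 0 = a ∧ β N = T ∧
      (∀ i < N, β i < β (i + 1)) ∧ ∀ i < N, ∀ c ∈ B, c ∉ Ioo (β i) (β (i + 1)) := by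
  induction N with
  | zero => exact fun T _ h => absurd h (Nat.not_lt_zero _)
  | succ N ih =>
    intro T haT hcard
    obtain rfl | hN := Nat.eq_zero_or_pos N
    · have hempty : ∀ c ∈ B, c ∉ Ioo a T := by
        exact Finset.filter_eq_empty_iff.1 (Finset.card_eq_zero.1 (Nat.lt_one_iff.1 hcard))
      refine ⟨fun i => if i = 0 then a else T, by simp, by simp, by simpa using haT, ?_⟩
      simpa using hempty
    suffices hex : ∃ c, a < c ∧ c < T ∧ (B.filter (· ∈ Ioo a c)).card < N ∧ ∀ d ∈ B, d ∉ Ioo c T by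
      obtain ⟨c, hac, hcT, hc, hd⟩ := hex
      obtain ⟨β, h0, h1, h2, h3⟩ := ih c hac hc
      refine ⟨Function.update β (N + 1) T, by simp [h0], by simp, ?_, ?_⟩
      · intro i hi
        rcases Nat.lt_succ_iff_lt_or_eq.1 hi with hi' | rfl
        · rw [Function.update_of_ne (by omega), Function.update_of_ne (by omega)]
          exact h2 i hi'
        · rw [Function.update_of_ne (by omega), Function.update_self, h1]
          exact hcT
      · intro i hi
        rcases Nat.lt_succ_iff_lt_or_eq.1 hi with hi' | rfl
        · rw [Function.update_of_ne (by omega), Function.update_of_ne (by omega)]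
          exact h3 i hi'
        · rw [Function.update_of_ne (by omega), Function.update_self, h1]
          exact hd
    -- Exactly `N` nondegenerate intervals are wanted: split off the part after the last point of
    -- `B`, or, if no points are left, half of the interval.
    rcases (B.filter (· ∈ Ioo a T)).eq_empty_or_nonempty with hB | hB
    · have hB' : ∀ c ∈ B, c ∉ Ioo a T := by simpa [Finset.filter_eq_empty_iff] using hB
      refine ⟨(a + T) / 2, by linarith, by linarith, ?_, ?_⟩
      · rw [Finset.filter_eq_empty_iff.2, Finset.card_empty]
        · exact hN
        · exact fun c hc hcm => hB' c hc ⟨hcm.1, by linarith [hcm.2]⟩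
      · exact fun d hd hdm => hB' d hd ⟨by linarith [hdm.1], hdm.2⟩
    · set c := (B.filter (· ∈ Ioo a T)).max' hB with hc
      have hcm : c ∈ B.filter (· ∈ Ioo a T) := Finset.max'_mem _ hB
      obtain ⟨hcB, hac, hcT⟩ := Finset.mem_filter.1 hcm
      refine ⟨c, hac, hcT, ?_, ?_⟩
      · have : (B.filter (· ∈ Ioo a c)).card < (B.filter (· ∈ Ioo a T)).card := by
          refine Finset.card_lt_card ((Finset.ssubset_iff_of_subset ?_).2 ⟨c, hcm, by simp⟩)
          intro d hd
          obtain ⟨h1, h2⟩ := Finset.mem_filter.1 hd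
          exact Finset.mem_filter.2 ⟨h1, h2.1, h2.2.trans hcT⟩
        omega
      · intro d hd hdm
        exact hdm.1.not_ge (Finset.le_max' _ _ (Finset.mem_filter.2 ⟨hd, hac.trans hdm.1, hdm.2⟩))

theorem sum_filter_val_lt {N : ℕ} (f : ℕ → ℝ) {m : ℕ} (hm : m ≤ N) :
    ∑ j ∈ Finset.univ.filter (fun j : Fin N => (j : ℕ) < m), f j = ∑ j ∈ Finset.range m, f j := by
  rw [Finset.sum_filter, Fin.sum_univ_eq_sum_range (fun j => if j < m then f j else 0) N,
    ← Finset.sum_filter]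
  congr 1
  ext j
  simp only [Finset.mem_filter, Finset.mem_range]
  omega

theorem setLIntegral_Ioc_eq_sum (β : ℕ → ℝ) (N : ℕ) (hβ : ∀ i < N, β i ≤ β (i + 1))
    (f : ℝ → ℝ≥0∞) :
    ∫⁻ x in Ioc (β 0) (β N), f x = ∑ i : Fin N, ∫⁻ x in Ioc (β i) (β (i + 1)), f x := by
  rw [Fin.sum_univ_eq_sum_range (fun i => ∫⁻ x in Ioc (β i) (β (i + 1)), f x)]
  induction N with
  | zero => simp
  | succ N ih =>
    have hmono : β 0 ≤ β N := by
      have : ∀ m ≤ N, β 0 ≤ β m := by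
        intro m
        induction m with
        | zero => exact fun _ => le_rfl
        | succ m ihm => exact fun hm => (ihm (by omega)).trans (hβ m (by omega))
      exact this N le_rfl
    rw [Finset.sum_range_succ, ← ih fun i hi => hβ i (by omega),
      ← Ioc_union_Ioc_eq_Ioc hmono (hβ N (by omega)), lintegral_union measurableSet_Ioc
        (Ioc_disjoint_Ioc_of_le le_rfl)]

namespace OUDRO

theorem leftEnd_eq {n : ℕ} (t : Param n) (i : Fin (steps n)) :
    leftEnd t i = ∑ j ∈ Finset.univ.filter (fun j : Fin (steps n) => (j : ℕ) < i), t.1 j := rfl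

theorem rightEnd_eq {n : ℕ} (t : Param n) (i : Fin (steps n)) :
    rightEnd t i = ∑ j ∈ Finset.univ.filter (fun j : Fin (steps n) => (j : ℕ) < i + 1), t.1 j := by
  unfold rightEnd
  congr 1
  ext j
  simp only [Finset.mem_filter, Finset.mem_univ, true_and, Fin.le_def]
  omega

theorem height_eq {n : ℕ} (t : Param n) (i : Fin (steps n)) :
    height t i =
      ∑ j ∈ Finset.univ.filter (fun j : Fin (steps n) => (j : ℕ) < steps n - i), t.2 j := by
  unfold height
  congr 1
  ext j
  simp only [Finset.mem_filter, Finset.mem_univ, true_and]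
  omega

/-- The integral of `F x (s x)` for the step function `s` with parameters `t`. -/
noncomputable def Data.stepIntegral {n : ℕ} (D : Data n) (t : Param n) (F : ℝ → ℝ → ℝ≥0∞) : ℝ≥0∞ :=
  ∑ i, ∫⁻ x in Ioc (D.x0 + leftEnd t i) (D.x0 + rightEnd t i), F x (D.y0 + height t i)

/-- An antitone function with at most `12 n + 2` jumps on a bounded interval is a step function with
admissible parameters. -/
theorem Data.exists_admissible {n : ℕ} (D : Data n) {b M : ℝ} {h : ℝ → ℝ} {B : Finset ℝ}
    (hh : AntitoneOn h (Ioo D.x0 b)) (hy0 : ∀ x ∈ Ioo D.x0 b, D.y0 ≤ h x)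
    (hM : ∀ x ∈ Ioo D.x0 b, h x ≤ M) (hs : IsStepOn B h D.x0 b) (hB : B.card < steps n)
    (hpos : ∫⁻ x in Ioo D.x0 b, D.areaFun (h x) ≠ 0) :
    ∃ t ∈ admissible n, ∑ j, t.2 j ≤ M - D.y0 ∧ ∑ i, t.1 i ≤ b - D.x0 ∧
      ∀ F : ℝ → ℝ → ℝ≥0∞, (∀ x, D.x0 < x → F x D.y0 = 0) →
        D.stepIntegral t F = ∫⁻ x in Ioo D.x0 b, F x (h x) := by
  have hex : ∃ x ∈ Ioo D.x0 b, D.y0 < h x := by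
    by_contra hcon
    push Not at hcon
    refine hpos ?_
    rw [setLIntegral_congr_fun (g := fun _ => 0) measurableSet_Ioo fun x hx => ?_]
    · simp
    · exact ENNReal.ofReal_eq_zero.2 (by linarith [hcon x hx])
  obtain ⟨x₁, hx₁, hx₁'⟩ := hex
  set U := {x | x ∈ Ioo D.x0 b ∧ D.y0 < h x}
  -- The part where `h` equals `y0` is cut off, as admissible parameters have only steps of positive
  -- height. It contributes nothing to integrands that vanish at height `y0`.
  set T := sSup U with hT
  have hUb : BddAbove U := ⟨b, fun x hx => hx.1.2.le⟩
  have hUne : U.Nonempty := ⟨x₁, hx₁, hx₁'⟩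
  have hxT : D.x0 < T := hx₁.1.trans_le (le_csSup hUb ⟨hx₁, hx₁'⟩)
  have hTb : T ≤ b := csSup_le hUne fun x hx => hx.1.2.le
  have hlow : ∀ x ∈ Ioo D.x0 T, D.y0 < h x := by
    intro x hx
    obtain ⟨y, hy, hxy⟩ := exists_lt_of_lt_csSup hUne hx.2
    exact hy.2.trans_le (hh ⟨hx.1, hx.2.trans_le hTb⟩ hy.1 hxy.le)
  have hhigh : ∀ x ∈ Ioo T b, h x = D.y0 := by
    intro x hx
    have hx' : x ∈ Ioo D.x0 b := ⟨hxT.trans hx.1, hx.2⟩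
    refine le_antisymm (not_lt.1 fun hlt => ?_) (hy0 x hx')
    exact hx.1.not_ge (le_csSup hUb ⟨hx', hlt⟩)
  obtain ⟨β, hβ0, hβN, hβ, hβB⟩ := exists_partition_of_card_lt B D.x0 (steps n) T hxT
    ((Finset.card_filter_le _ _).trans_lt hB)
  have hβmono : ∀ i j, i ≤ j → j ≤ steps n → β i ≤ β j := by
    intro i j hij
    induction j, hij using Nat.le_induction with
    | base => exact fun _ => le_rfl
    | succ j _ ih => exact fun hj => (ih (by omega)).trans (hβ j (by omega)).le
  have hβT : ∀ i < steps n, Ioo (β i) (β (i + 1)) ⊆ Ioo D.x0 T := fun i hi =>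
    Ioo_subset_Ioo (hβ0 ▸ hβmono 0 i (by omega) (by omega))
      (hβN ▸ hβmono (i + 1) (steps n) (by omega) le_rfl)
  set mid : ℕ → ℝ := fun i => (β i + β (i + 1)) / 2
  have hmid : ∀ i < steps n, mid i ∈ Ioo (β i) (β (i + 1)) := fun i hi => by
    have := hβ i hi
    constructor <;> simp only [mid] <;> linarith
  have hTb' : Ioo D.x0 T ⊆ Ioo D.x0 b := Ioo_subset_Ioo_right hTb
  have hconst : ∀ i < steps n, ∀ x ∈ Ioo (β i) (β (i + 1)), h x = h (mid i) := by
    intro i hi x hx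
    have hx' := hTb' (hβT i hi hx)
    have hm' := hTb' (hβT i hi (hmid i hi))
    rcases le_total x (mid i) with hle | hle
    · exact hs x hx' _ hm' hle fun c hc hcm =>
        hβB i hi c hc ⟨hx.1.trans_le hcm.1, hcm.2.trans_lt (hmid i hi).2⟩
    · exact (hs _ hm' x hx' hle fun c hc hcm =>
        hβB i hi c hc ⟨(hmid i hi).1.trans_le hcm.1, hcm.2.trans_lt hx.2⟩).symm
  have hHanti : ∀ i j, i ≤ j → j < steps n → h (mid j) ≤ h (mid i) := by
    intro i j hij hj
    rcases hij.eq_or_lt with rfl | hlt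
    · exact le_rfl
    · refine hh (hTb' (hβT i (by omega) (hmid i (by omega)))) (hTb' (hβT j hj (hmid j hj))) ?_
      exact (hmid i (by omega)).2.le.trans ((hβmono (i + 1) j hlt (by omega)).trans (hmid j hj).1.le)
  -- The heights in increasing order, hence from right to left, starting from `y0`. Their increments
  -- are the `w`'s, and the first `steps n - i` of them telescope to the height of step `i`.
  set v : ℕ → ℝ := fun j => if j = 0 then D.y0 else h (mid (steps n - j))
  have hvpos : ∀ j, j ≠ 0 → v j = h (mid (steps n - j)) := fun j hj => by simp [v, hj]
  let t : Param n := (fun i => β (i + 1) - β i, fun j => v (j + 1) - v j)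
  have hleft : ∀ i, D.x0 + leftEnd t i = β i := fun i => by
    rw [leftEnd_eq, sum_filter_val_lt (fun j => β (j + 1) - β j) i.2.le, Finset.sum_range_sub, hβ0]
    ring
  have hright : ∀ i, D.x0 + rightEnd t i = β (i + 1) := fun i => by
    rw [rightEnd_eq, sum_filter_val_lt (fun j => β (j + 1) - β j) (Nat.succ_le_of_lt i.2),
      Finset.sum_range_sub, hβ0]
    ring
  have hv0 : v 0 = D.y0 := by simp [v]
  have hheight : ∀ i, D.y0 + height t i = h (mid i) := fun i => by
    rw [height_eq, sum_filter_val_lt (fun j => v (j + 1) - v j) (Nat.sub_le _ _),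
      Finset.sum_range_sub, hv0, hvpos _ (by omega)]
    have : steps n - (steps n - i) = i := by omega
    rw [this]
    ring
  have hN : 0 < steps n := by unfold steps; omega
  refine ⟨t, ⟨fun i => sub_pos.2 (hβ i i.2), ?_, fun j => sub_nonneg.2 ?_⟩, ?_, ?_, ?_⟩
  · have : v 1 - v 0 = h (mid (steps n - 1)) - D.y0 := by rw [hv0, hvpos 1 one_ne_zero]
    have hlt := hlow _ (hβT (steps n - 1) (by omega) (hmid (steps n - 1) (by omega)))
    change 0 < v (0 + 1) - v 0
    rw [zero_add, this]
    linarith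
  · rw [hvpos (j + 1) (by omega)]
    by_cases hj : (j : ℕ) = 0
    · rw [hj, hv0]
      exact (hlow _ (hβT _ (by omega) (hmid _ (by omega)))).le
    · rw [hvpos _ hj]
      exact hHanti _ _ (by omega) (by omega)
  · have hsum : ∑ j, t.2 j = v (steps n) - v 0 := by
      rw [← Finset.sum_range_sub]
      exact Fin.sum_univ_eq_sum_range (fun j => v (j + 1) - v j) (steps n)
    rw [hsum, hv0, hvpos _ hN.ne']
    exact sub_le_sub_right (hM _ (hTb' (hβT _ (by omega) (hmid _ (by omega))))) _
  · have hsum : ∑ i, t.1 i = β (steps n) - β 0 := by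
      rw [← Finset.sum_range_sub]
      exact Fin.sum_univ_eq_sum_range (fun j => β (j + 1) - β j) (steps n)
    rw [hsum, hβ0, hβN]
    linarith
  · intro F hF
    have h1 : ∫⁻ x in Ioo D.x0 b, F x (h x) = ∫⁻ x in Ioc D.x0 T, F x (h x) := by
      rw [setLIntegral_congr (Ioo_ae_eq_Ioc (a := D.x0) (b := b)), ← Ioc_union_Ioc_eq_Ioc hxT.le hTb,
        lintegral_union measurableSet_Ioc (Ioc_disjoint_Ioc_of_le le_rfl),
        setLIntegral_congr (Ioo_ae_eq_Ioc (a := T) (b := b)).symm,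
        setLIntegral_congr_fun (g := fun _ => 0) measurableSet_Ioo fun x hx => by
          simp only [hhigh x hx, hF x (hxT.trans hx.1)]]
      simp
    have h2 := setLIntegral_Ioc_eq_sum β (steps n) (fun i hi => (hβ i hi).le) fun x => F x (h x)
    rw [hβ0, hβN] at h2
    rw [h1, h2, Data.stepIntegral]
    refine Finset.sum_congr rfl fun i _ => ?_
    rw [hleft, hright, hheight, setLIntegral_congr (Ioo_ae_eq_Ioc (a := β i)).symm,
      setLIntegral_congr (Ioo_ae_eq_Ioc (a := β i)).symm]
    exact setLIntegral_congr_fun measurableSet_Ioo fun x hx => by simp only [hconst i i.2 x hx]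

end OUDRO

/-! ### Areas of orthounimodal regions through their vertical slices -/

/-- Null-measurability is the right generality: `f` and `g` are only almost everywhere measurable,
so superlevel sets and the rare event need not be measurable. Almost every slice is still
null-measurable. -/
theorem volume_eq_lintegral_slice {A : Set (ℝ × ℝ)} (hA : NullMeasurableSet A volume) :
    volume A = ∫⁻ x, volume {y | (x, y) ∈ A} := by
  have hmeas : AEMeasurable (A.indicator (1 : ℝ × ℝ → ℝ≥0∞)) (volume.prod volume) :=
    (aemeasurable_indicator_const_iff (1 : ℝ≥0∞)).2 hA
  have hA' : NullMeasurableSet A (volume.prod volume) := hA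
  have hslice : ∀ᵐ x : ℝ, NullMeasurableSet {y | (x, y) ∈ A} volume := by
    obtain ⟨A', _, hA'm, hAA'⟩ := hA'.exists_measurable_superset_ae_eq
    have := Measure.ae_ae_of_ae_prod (hAA' : ∀ᵐ q ∂(volume.prod volume), _)
    filter_upwards [this] with x hx
    have hm : MeasurableSet {y | (x, y) ∈ A'} := hA'm.preimage measurable_prodMk_left
    exact hm.nullMeasurableSet.congr hx
  calc volume A = ∫⁻ q, A.indicator 1 q ∂(volume.prod volume) :=
        (lintegral_indicator_one₀ hA').symm
    _ = ∫⁻ x, ∫⁻ y, A.indicator 1 (x, y) := lintegral_prod _ hmeas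
    _ = ∫⁻ x, volume {y | (x, y) ∈ A} := by
        refine lintegral_congr_ae ?_
        filter_upwards [hslice] with x hx
        exact lintegral_indicator_one₀ (μ := volume) hx

namespace OUDRO

theorem Data.measurableSet_tail {n : ℕ} (D : Data n) : MeasurableSet D.tail :=
  (measurableSet_le measurable_const measurable_fst).inter
    (measurableSet_le measurable_const measurable_snd)

theorem Data.measurableSet_box {n : ℕ} (D : Data n) (k : Fin n) : MeasurableSet (D.box k) :=
  (measurableSet_le measurable_const measurable_fst).inter
    ((measurableSet_le measurable_fst.coe_real_ereal measurable_const).inter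
      ((measurableSet_le measurable_const measurable_snd).inter
        (measurableSet_le measurable_snd.coe_real_ereal measurable_const)))

theorem Data.nullMeasurableSet_rareEvent {n : ℕ} {D : Data n}
    (hg : AEMeasurable D.g (volume.restrict (Ici D.x0))) :
    NullMeasurableSet D.rareEvent volume := by
  have hm : MeasurableSet {q | q ∈ D.tail ∧ hg.mk D.g q.1 ≤ (q.2 : EReal)} :=
    D.measurableSet_tail.inter
      (measurableSet_le (hg.measurable_mk.comp measurable_fst) measurable_snd.coe_real_ereal)
  refine hm.nullMeasurableSet.congr ?_
  have h1 : ∀ᵐ x : ℝ, x ∈ Ici D.x0 → D.g x = hg.mk D.g x :=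
    (ae_restrict_iff' measurableSet_Ici).1 hg.ae_eq_mk
  have h2 : ∀ᵐ q : ℝ × ℝ, q.1 ∈ Ici D.x0 → D.g q.1 = hg.mk D.g q.1 :=
    Measure.quasiMeasurePreserving_fst.ae h1
  filter_upwards [h2] with q hq
  refine propext (and_congr_right fun hqt => ?_)
  rw [hq hqt.1]

/-- The orthounimodal regions: subsets of the tail region that contain every point of it to the left
of and below one of their points. -/
structure Data.IsLower {n : ℕ} (D : Data n) (R : Set (ℝ × ℝ)) : Prop where
  subset_tail : R ⊆ D.tail
  mem_of_le : ∀ {x' x y' y : ℝ}, (x, y) ∈ R → D.x0 ≤ x' → x' ≤ x → D.y0 ≤ y' → y' ≤ y →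
    (x', y') ∈ R

/-- The ordinate of the upper end of the vertical slice of `R` at `x`. -/
noncomputable def Data.top {n : ℕ} (D : Data n) (R : Set (ℝ × ℝ)) (x : ℝ) : ℝ :=
  D.y0 + (volume {y | (x, y) ∈ R}).toReal

theorem Data.le_top {n : ℕ} (D : Data n) (R : Set (ℝ × ℝ)) (x : ℝ) : D.y0 ≤ D.top R x :=
  le_add_of_nonneg_right ENNReal.toReal_nonneg

namespace Data.IsLower

variable {n : ℕ} {D : Data n} {R : Set (ℝ × ℝ)}

theorem slice_subset (hR : D.IsLower R) {x x' : ℝ} (hx' : D.x0 ≤ x') (hxx' : x' ≤ x) :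
    {y | (x, y) ∈ R} ⊆ {y | (x', y) ∈ R} := fun _ hy =>
  hR.mem_of_le hy hx' hxx' (hR.subset_tail hy).2 le_rfl

theorem slice_ne_top (hR : D.IsLower R) (hfin : volume {y | (D.x0, y) ∈ R} ≠ ∞) {x : ℝ}
    (hx : D.x0 ≤ x) : volume {y | (x, y) ∈ R} ≠ ∞ :=
  ne_top_of_le_ne_top hfin (measure_mono (hR.slice_subset le_rfl hx))

theorem antitoneOn_top (hR : D.IsLower R) (hfin : volume {y | (D.x0, y) ∈ R} ≠ ∞) :
    AntitoneOn (D.top R) (Ici D.x0) := fun _ hx _ _ hxy =>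
  add_le_add_right (ENNReal.toReal_mono (hR.slice_ne_top hfin hx)
    (measure_mono (hR.slice_subset hx hxy))) _

/-- A slice is an interval which, if nonempty, starts at `y0`. It is contained in the closed
interval from `y0` of the same finite length, so the two differ by a null set. -/
theorem slice_ae_eq (hR : D.IsLower R) {x : ℝ} (hx : D.x0 ≤ x)
    (hfin : volume {y | (x, y) ∈ R} ≠ ∞) :
    ({y | (x, y) ∈ R} : Set ℝ) =ᵐ[volume] Icc D.y0 (D.top R x) := by
  have hoc : OrdConnected {y | (x, y) ∈ R} := ⟨fun y hy z hz w hw =>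
    hR.mem_of_le hz hx le_rfl ((hR.subset_tail hy).2.trans hw.1) hw.2⟩
  refine ae_eq_of_subset_of_measure_ge ?_ ?_ hoc.measurableSet.nullMeasurableSet (by simp)
  · intro y hy
    have hy0 := (hR.subset_tail hy).2
    refine ⟨hy0, ?_⟩
    have hsub : Icc D.y0 y ⊆ {y | (x, y) ∈ R} := fun z hz => hR.mem_of_le hy hx le_rfl hz.1 hz.2
    have h1 := measure_mono (μ := volume) hsub
    rw [Real.volume_Icc, ENNReal.ofReal_le_iff_le_toReal hfin] at h1
    simp only [Data.top]
    linarith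
  · rw [Real.volume_Icc, Data.top, add_sub_cancel_left, ENNReal.ofReal_toReal hfin]

/-- Fubini reduces an area to the lengths of vertical segments from `y0` to the upper boundary.
Finiteness of the slice at `x0` suffices, as it contains all the others. -/
theorem volume_inter_eq (hR : D.IsLower R) (hRm : NullMeasurableSet R volume)
    (hfin : volume {y | (D.x0, y) ∈ R} ≠ ∞) {S : Set (ℝ × ℝ)} (hS : NullMeasurableSet S volume)
    {F : ℝ → ℝ → ℝ≥0∞} (hF : ∀ x, D.x0 ≤ x → ∀ v, D.y0 ≤ v →
      volume (Icc D.y0 v ∩ {y | (x, y) ∈ S}) = F x v) :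
    volume (R ∩ S) = ∫⁻ x in Ici D.x0, F x (D.top R x) := by
  rw [volume_eq_lintegral_slice (hRm.inter hS), ← lintegral_indicator measurableSet_Ici]
  refine lintegral_congr fun x => ?_
  by_cases hx : D.x0 ≤ x
  · rw [indicator_of_mem (show x ∈ Ici D.x0 from hx), ← hF x hx _ (D.le_top R x)]
    exact measure_congr ((hR.slice_ae_eq hx (hR.slice_ne_top hfin hx)).inter (ae_eq_refl _))
  · rw [indicator_of_notMem (show x ∉ Ici D.x0 from hx)]
    refine measure_mono_null (fun y hy => ?_) measure_empty
    exact hx (hR.subset_tail hy.1).1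

theorem volume_eq (hR : D.IsLower R) (hRm : NullMeasurableSet R volume)
    (hfin : volume {y | (D.x0, y) ∈ R} ≠ ∞) :
    volume R = ∫⁻ x in Ici D.x0, D.areaFun (D.top R x) := by
  rw [← hR.volume_inter_eq hRm hfin (F := fun _ v => D.areaFun v)
    MeasurableSet.univ.nullMeasurableSet, inter_univ]
  intro x _ v _
  simp [Data.areaFun]

theorem volume_inter_box (hR : D.IsLower R) (hRm : NullMeasurableSet R volume)
    (hfin : volume {y | (D.x0, y) ∈ R} ≠ ∞) (k : Fin n) (hy0 : D.y0 ≤ D.y1 k)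
    (hy : (D.y1 k : EReal) ≤ D.y2 k) :
    volume (R ∩ D.box k) = ∫⁻ x in Ici D.x0, D.boxFun k x (D.top R x) := by
  refine hR.volume_inter_eq hRm hfin (D.measurableSet_box k).nullMeasurableSet fun x _ v _ => ?_
  by_cases hx : D.x1 k ≤ x ∧ (x : EReal) ≤ D.x2 k
  swap
  · rw [Data.boxFun, indicator_of_notMem (show x ∉ {x : ℝ | D.x1 k ≤ x ∧ (x : EReal) ≤ D.x2 k}
      from hx)]
    exact measure_mono_null (fun y hy => hx ⟨hy.2.1, hy.2.2.1⟩) measure_empty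
  rw [Data.boxFun, indicator_of_mem (show x ∈ {x : ℝ | D.x1 k ≤ x ∧ (x : EReal) ≤ D.x2 k} from hx)]
  have hset : Icc D.y0 v ∩ {y | (x, y) ∈ D.box k} =
      {y | D.y1 k ≤ y ∧ (y : EReal) ≤ min (v : EReal) (D.y2 k)} := by
    ext y
    simp only [Data.box, mem_inter_iff, mem_Icc, mem_ofPred_eq, le_min_iff, EReal.coe_le_coe_iff]
    constructor
    · rintro ⟨⟨_, h2⟩, _, _, h5, h6⟩
      exact ⟨h5, h2, h6⟩
    · rintro ⟨h5, h2, h6⟩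
      exact ⟨⟨hy0.trans h5, h2⟩, hx.1, hx.2, h5, h6⟩
  rw [hset]
  obtain ⟨r, hr⟩ : ∃ r : ℝ, (r : EReal) = min (v : EReal) (D.y2 k) := by
    refine ⟨_, EReal.coe_toReal (ne_top_of_le_ne_top (EReal.coe_ne_top v) (min_le_left _ _)) ?_⟩
    refine ne_bot_of_le_ne_bot (b := ((min v (D.y1 k) : ℝ) : EReal)) (EReal.coe_ne_bot _) ?_
    refine le_min ?_ (le_trans ?_ hy)
    · exact_mod_cast min_le_left _ _
    · exact_mod_cast min_le_right _ _
  have hrv : r ≤ v := by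
    have : (r : EReal) ≤ v := hr ▸ min_le_left _ _
    exact_mod_cast this
  rw [← hr]
  have hIcc : {y : ℝ | D.y1 k ≤ y ∧ (y : EReal) ≤ r} = Icc (D.y1 k) r := by
    ext y
    simp
  rw [hIcc, Real.volume_Icc]
  rcases le_total (D.y1 k) v with h | h
  · rw [min_eq_right (b := ((D.y1 k : ℝ) : EReal)) (by exact_mod_cast h), ← EReal.coe_sub,
      EReal.toENNReal_of_ne_top (EReal.coe_ne_top _), EReal.toReal_coe]
  · rw [min_eq_left (b := ((D.y1 k : ℝ) : EReal)) (by exact_mod_cast h), ← EReal.coe_sub,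
      EReal.toENNReal_of_ne_top (EReal.coe_ne_top _), EReal.toReal_coe,
      ENNReal.ofReal_of_nonpos (by linarith), ENNReal.ofReal_of_nonpos (by linarith)]

theorem volume_inter_rareEvent (hR : D.IsLower R) (hRm : NullMeasurableSet R volume)
    (hfin : volume {y | (D.x0, y) ∈ R} ≠ ∞)
    (hg : AEMeasurable D.g (volume.restrict (Ici D.x0)))
    (hgy : ∀ x, D.x0 ≤ x → (D.y0 : EReal) ≤ D.g x) :
    volume (R ∩ D.rareEvent) = ∫⁻ x in Ici D.x0, D.objFun x (D.top R x) := by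
  refine hR.volume_inter_eq hRm hfin (Data.nullMeasurableSet_rareEvent hg) fun x hx v _ => ?_
  have hset : Icc D.y0 v ∩ {y | (x, y) ∈ D.rareEvent} = {y : ℝ | D.g x ≤ y ∧ y ≤ v} := by
    ext y
    simp only [Data.rareEvent, Data.tail, mem_inter_iff, mem_Icc, mem_ofPred_eq]
    constructor
    · rintro ⟨⟨_, h2⟩, _, h5⟩
      exact ⟨h5, h2⟩
    · rintro ⟨h5, h2⟩
      have h0 : D.y0 ≤ y := by exact_mod_cast (hgy x hx).trans h5
      exact ⟨⟨h0, h2⟩, ⟨hx, h0⟩, h5⟩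
  rw [hset, Data.objFun]
  have hgx := hgy x hx
  generalize D.g x = e at hgx
  induction e with
  | bot => exact absurd hgx (by simp)
  | top => simp
  | coe e =>
    have hIcc : {y : ℝ | (e : EReal) ≤ y ∧ y ≤ v} = Icc e v := by
      ext y
      simp
    rw [hIcc, Real.volume_Icc, ← EReal.coe_sub,
      EReal.toENNReal_of_ne_top (EReal.coe_ne_top _), EReal.toReal_coe]

/-- A point of `R` above `x` forces the bottom segment from `x0` to `x` into `R`, so `x - x0` is at
most the width. -/
theorem top_eq_of_lt (hR : D.IsLower R) (hwidth : volume {x | (x, D.y0) ∈ R} ≠ ∞) {x : ℝ}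
    (hx : D.x0 + (volume {x | (x, D.y0) ∈ R}).toReal < x) : D.top R x = D.y0 := by
  have hempty : {y | (x, y) ∈ R} = ∅ := by
    rw [eq_empty_iff_forall_notMem]
    intro y hy
    have hsub : Icc D.x0 x ⊆ {x | (x, D.y0) ∈ R} := fun z hz =>
      hR.mem_of_le hy hz.1 hz.2 le_rfl (hR.subset_tail hy).2
    have h1 := measure_mono (μ := volume) hsub
    rw [Real.volume_Icc, ENNReal.ofReal_le_iff_le_toReal hwidth] at h1
    linarith
  simp [Data.top, hempty]

end Data.IsLower

theorem Data.areaFun_y0 {n : ℕ} (D : Data n) : D.areaFun D.y0 = 0 := by simp [Data.areaFun]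

theorem Data.boxFun_y0 {n : ℕ} (D : Data n) (k : Fin n) (hy0 : D.y0 ≤ D.y1 k)
    (hy : (D.y1 k : EReal) ≤ D.y2 k) (x : ℝ) : D.boxFun k x D.y0 = 0 := by
  have h1 : ((D.y0 : ℝ) : EReal) ≤ ((D.y1 k : ℝ) : EReal) := by exact_mod_cast hy0
  rw [Data.boxFun, min_eq_left h1, min_eq_left (h1.trans hy),
    EReal.toENNReal_of_nonpos EReal.sub_self_le_zero, indicator_zero]

theorem Data.objFun_y0 {n : ℕ} {D : Data n} (hgy : ∀ x, D.x0 ≤ x → (D.y0 : EReal) ≤ D.g x) {x : ℝ}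
    (hx : D.x0 ≤ x) : D.objFun x D.y0 = 0 :=
  EReal.toENNReal_of_nonpos (EReal.sub_nonpos.2 (hgy x hx))

end OUDRO

/-! ### Step regions, and the integrands of the moment problem as normalized areas -/

namespace OUDRO

section Param

variable {n : ℕ} {t : Param n}

theorem first_le (i : Fin (steps n)) : first n ≤ i := Fin.mk_le_of_le_val (Nat.zero_le _)

theorem rightEnd_eq_add (t : Param n) (i : Fin (steps n)) : rightEnd t i = leftEnd t i + t.1 i := by
  have hset : Finset.univ.filter (· ≤ i) = insert i (Finset.univ.filter (· < i)) := by
    ext j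
    simp [le_iff_eq_or_lt]
  rw [rightEnd, leftEnd, hset, Finset.sum_insert (by simp), add_comm]

theorem leftEnd_nonneg (ht : t ∈ admissible n) (i : Fin (steps n)) : 0 ≤ leftEnd t i :=
  Finset.sum_nonneg fun j _ => (ht.1 j).le

theorem leftEnd_lt_rightEnd (ht : t ∈ admissible n) (i : Fin (steps n)) :
    leftEnd t i < rightEnd t i := by
  rw [rightEnd_eq_add]
  linarith [ht.1 i]

theorem rightEnd_le_leftEnd (ht : t ∈ admissible n) {i j : Fin (steps n)} (hij : i < j) :
    rightEnd t i ≤ leftEnd t j := by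
  refine Finset.sum_le_sum_of_subset_of_nonneg (fun k hk => ?_) fun k _ _ => (ht.1 k).le
  simp only [Finset.mem_filter, Finset.mem_univ, true_and] at hk ⊢
  exact hk.trans_lt hij

theorem rightEnd_le_sum (ht : t ∈ admissible n) (i : Fin (steps n)) : rightEnd t i ≤ ∑ j, t.1 j :=
  Finset.sum_le_sum_of_subset_of_nonneg (Finset.filter_subset _ _) fun k _ _ => (ht.1 k).le

theorem exists_rightEnd_eq_sum (t : Param n) : ∃ i, rightEnd t i = ∑ j, t.1 j := by
  have hN : 0 < steps n := by unfold steps; omega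
  refine ⟨⟨steps n - 1, by omega⟩, ?_⟩
  rw [rightEnd, Finset.filter_true_of_mem]
  intro j _
  have := j.2
  exact Fin.le_def.2 (Nat.le_sub_one_of_lt this)

theorem leftEnd_first (t : Param n) : leftEnd t (first n) = 0 := by
  rw [leftEnd, Finset.filter_false_of_mem, Finset.sum_empty]
  exact fun j _ => (first_le j).not_gt

theorem height_pos (ht : t ∈ admissible n) (i : Fin (steps n)) : 0 < height t i := by
  refine Finset.sum_pos' (fun j _ => ht.2.2 j) ⟨first n, ?_, ht.2.1⟩
  simp only [Finset.mem_filter, Finset.mem_univ, true_and, first, add_zero]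
  exact i.2

theorem height_anti (ht : t ∈ admissible n) {i j : Fin (steps n)} (hij : i ≤ j) :
    height t j ≤ height t i := by
  refine Finset.sum_le_sum_of_subset_of_nonneg (fun k hk => ?_) fun k _ _ => ht.2.2 k
  simp only [Finset.mem_filter, Finset.mem_univ, true_and] at hk ⊢
  have := Fin.le_def.1 hij
  omega

theorem height_first (t : Param n) : height t (first n) = ∑ j, t.2 j := by
  rw [height, Finset.filter_true_of_mem]
  intro j _
  simp only [first, zero_add]
  exact j.2

theorem area_eq (t : Param n) : area t = ∑ i, t.1 i * height t i := by
  simp only [area, height, Finset.mul_sum]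

theorem area_pos (ht : t ∈ admissible n) : 0 < area t := by
  rw [area_eq]
  exact Finset.sum_pos (fun i _ => mul_pos (ht.1 i) (height_pos ht i)) ⟨first n, Finset.mem_univ _⟩

variable (D : Data n)

theorem Data.lt_of_mem_stepInterval {x : ℝ} {i : Fin (steps n)} (hi : i ≠ first n)
    (hx : x ∈ D.stepInterval t i) : D.x0 + leftEnd t i < x := by
  rw [Data.stepInterval, if_neg hi] at hx
  exact hx.1

theorem Data.le_of_mem_stepInterval {x : ℝ} {i : Fin (steps n)} (hx : x ∈ D.stepInterval t i) :
    x ≤ D.x0 + rightEnd t i := by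
  unfold Data.stepInterval at hx
  split_ifs at hx
  · exact hx.2
  · exact hx.2

theorem Data.x0_le_of_mem_stepInterval (ht : t ∈ admissible n) {x : ℝ} {i : Fin (steps n)}
    (hx : x ∈ D.stepInterval t i) : D.x0 ≤ x := by
  unfold Data.stepInterval at hx
  split_ifs at hx
  · exact hx.1
  · linarith [hx.1, leftEnd_nonneg ht i]

theorem Data.le_of_mem_stepInterval_of_le (ht : t ∈ admissible n) {x x' : ℝ} {i j : Fin (steps n)}
    (hxx' : x' ≤ x) (hx' : x' ∈ D.stepInterval t i) (hx : x ∈ D.stepInterval t j) : i ≤ j := by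
  by_contra hcon
  have hlt := not_le.1 hcon
  have h1 := D.lt_of_mem_stepInterval (ne_of_gt ((first_le j).trans_lt hlt)) hx'
  have h2 := D.le_of_mem_stepInterval hx
  linarith [rightEnd_le_leftEnd ht hlt]

theorem Data.exists_mem_stepInterval {x : ℝ} (hx0 : D.x0 ≤ x)
    (hx : x ≤ D.x0 + ∑ j, t.1 j) : ∃ i, x ∈ D.stepInterval t i := by
  obtain ⟨l, hl⟩ := exists_rightEnd_eq_sum t
  obtain ⟨i, hi, hmin⟩ := Finset.exists_minimal
    (s := Finset.univ.filter fun i => x ≤ D.x0 + rightEnd t i) ⟨l, by simpa [hl] using hx⟩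
  simp only [Finset.mem_filter, Finset.mem_univ, true_and] at hi hmin
  refine ⟨i, ?_⟩
  unfold Data.stepInterval
  split_ifs with hfirst
  · exact ⟨hx0, hi⟩
  · refine ⟨?_, hi⟩
    by_contra hcon
    have hipos : 0 < (i : ℕ) := Nat.pos_of_ne_zero fun h => hfirst (Fin.ext h)
    set j : Fin (steps n) := ⟨i - 1, by omega⟩ with hj
    have hji : j < i := Fin.lt_def.2 (by simp only [hj]; omega)
    have hset : leftEnd t i = rightEnd t j := by
      rw [leftEnd, rightEnd]
      congr 1
      ext k
      simp only [Finset.mem_filter, Finset.mem_univ, true_and, Fin.lt_def, Fin.le_def, hj]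
      omega
    exact (hmin (hset ▸ not_lt.1 hcon) hji.le).not_gt hji

theorem Data.isLower_stepRegion (ht : t ∈ admissible n) : D.IsLower (D.stepRegion t) where
  subset_tail := fun _ ⟨hy, _, hi, _⟩ => ⟨D.x0_le_of_mem_stepInterval ht hi, hy⟩
  mem_of_le := by
    rintro x' x y' y ⟨_, j, hj, hyj⟩ hx' hxx' hy' hyy'
    obtain ⟨i, hi⟩ := D.exists_mem_stepInterval hx' (hxx'.trans
      ((D.le_of_mem_stepInterval hj).trans (by linarith [rightEnd_le_sum ht j])))
    have := height_anti ht (D.le_of_mem_stepInterval_of_le ht hxx' hi hj)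
    exact ⟨hy', i, hi, by dsimp only at *; linarith⟩

theorem Data.slice_stepRegion (ht : t ∈ admissible n) {x : ℝ} {i : Fin (steps n)}
    (hx : x ∈ D.stepInterval t i) :
    {y | (x, y) ∈ D.stepRegion t} = Icc D.y0 (D.y0 + height t i) := by
  ext y
  constructor
  · rintro ⟨hy, j, hj, hyj⟩
    have hij : j = i := le_antisymm (D.le_of_mem_stepInterval_of_le ht le_rfl hj hx)
      (D.le_of_mem_stepInterval_of_le ht le_rfl hx hj)
    exact ⟨hy, hij ▸ hyj⟩
  · exact fun hy => ⟨hy.1, i, hx, hy.2⟩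

theorem Data.x0_mem_stepInterval (ht : t ∈ admissible n) :
    D.x0 ∈ D.stepInterval t (first n) := by
  rw [Data.stepInterval, if_pos rfl]
  have := leftEnd_lt_rightEnd ht (first n)
  rw [leftEnd_first] at this
  exact ⟨le_rfl, by linarith⟩

theorem Data.slice_stepRegion_x0 (ht : t ∈ admissible n) :
    {y | (D.x0, y) ∈ D.stepRegion t} = Icc D.y0 (D.y0 + ∑ j, t.2 j) := by
  rw [D.slice_stepRegion ht (D.x0_mem_stepInterval ht), height_first]

theorem Data.slice_stepRegion_y0 (ht : t ∈ admissible n) :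
    {x | (x, D.y0) ∈ D.stepRegion t} = Icc D.x0 (D.x0 + ∑ j, t.1 j) := by
  ext x
  constructor
  · rintro ⟨_, i, hi, _⟩
    exact ⟨D.x0_le_of_mem_stepInterval ht hi, (D.le_of_mem_stepInterval hi).trans
      (by linarith [rightEnd_le_sum ht i])⟩
  · rintro ⟨h1, h2⟩
    obtain ⟨i, hi⟩ := D.exists_mem_stepInterval h1 h2
    exact ⟨le_rfl, i, hi, by dsimp only; linarith [height_pos ht i]⟩

theorem Data.top_stepRegion (ht : t ∈ admissible n) {x : ℝ} {i : Fin (steps n)}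
    (hx : x ∈ Ioc (D.x0 + leftEnd t i) (D.x0 + rightEnd t i)) :
    D.top (D.stepRegion t) x = D.y0 + height t i := by
  have hx' : x ∈ D.stepInterval t i := by
    unfold Data.stepInterval
    split_ifs
    · exact ⟨by linarith [hx.1, leftEnd_nonneg ht i], hx.2⟩
    · exact hx
  rw [Data.top, D.slice_stepRegion ht hx', Real.volume_Icc, add_sub_cancel_left,
    ENNReal.toReal_ofReal (height_pos ht i).le]

/-- The bridge between the explicit sums in the integrands and the areas of the region: the boundary
of the step region is constant on each step and equals `y0` beyond the last one. -/
theorem Data.stepIntegral_eq (ht : t ∈ admissible n) {F : ℝ → ℝ → ℝ≥0∞}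
    (hF : ∀ x, D.x0 < x → F x D.y0 = 0) :
    D.stepIntegral t F = ∫⁻ x in Ici D.x0, F x (D.top (D.stepRegion t) x) := by
  let β : ℕ → ℝ := fun m => D.x0 +
    ∑ j ∈ Finset.univ.filter (fun j : Fin (steps n) => (j : ℕ) < m), t.1 j
  have hβ0 : β 0 = D.x0 := by simp [β]
  have hβN : β (steps n) = D.x0 + ∑ j, t.1 j := by
    simp only [β]
    rw [Finset.filter_true_of_mem fun j _ => j.2]
  have hβ : ∀ i < steps n, β i ≤ β (i + 1) := fun i _ => by
    refine add_le_add_right (Finset.sum_le_sum_of_subset_of_nonneg (fun k hk => ?_)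
      fun k _ _ => (ht.1 k).le) _
    simp only [Finset.mem_filter, Finset.mem_univ, true_and] at hk ⊢
    omega
  have hx0 : D.x0 ≤ D.x0 + ∑ j, t.1 j := by
    linarith [Finset.sum_nonneg fun j (_ : j ∈ Finset.univ) => (ht.1 j).le]
  have hsum := setLIntegral_Ioc_eq_sum β (steps n) hβ fun x => F x (D.top (D.stepRegion t) x)
  rw [hβ0, hβN] at hsum
  have hwidth : volume {x | (x, D.y0) ∈ D.stepRegion t} = ENNReal.ofReal (∑ j, t.1 j) := by
    rw [D.slice_stepRegion_y0 ht, Real.volume_Icc, add_sub_cancel_left]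
  have hzero : ∀ x ∈ Ioi (D.x0 + ∑ j, t.1 j), F x (D.top (D.stepRegion t) x) = 0 := by
    intro x hx
    rw [(D.isLower_stepRegion ht).top_eq_of_lt (by rw [hwidth]; exact ENNReal.ofReal_ne_top)]
    · exact hF x (hx0.trans_lt hx)
    · rw [hwidth, ENNReal.toReal_ofReal (by linarith)]
      exact hx
  rw [← setLIntegral_congr (Ioi_ae_eq_Ici (a := D.x0)), ← Ioc_union_Ioi_eq_Ioi hx0,
    lintegral_union measurableSet_Ioi (by
      rw [Set.disjoint_left]; exact fun x hx hx' => hx.2.not_gt hx'),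
    setLIntegral_congr_fun measurableSet_Ioi hzero, lintegral_zero, add_zero, hsum]
  refine Finset.sum_congr rfl fun i _ => ?_
  have hright : β (i + 1) = D.x0 + rightEnd t i := by rw [rightEnd_eq]
  have hleft : β i = D.x0 + leftEnd t i := rfl
  rw [hright, hleft]
  exact setLIntegral_congr_fun measurableSet_Ioc fun x hx => by
    simp only [D.top_stepRegion ht hx]

theorem Data.stepIntegral_areaFun (ht : t ∈ admissible n) :
    D.stepIntegral t (fun _ v => D.areaFun v) = ENNReal.ofReal (area t) := by
  rw [area_eq, ENNReal.ofReal_sum_of_nonneg fun i _ =>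
    mul_nonneg (ht.1 i).le (height_pos ht i).le]
  refine Finset.sum_congr rfl fun i _ => ?_
  rw [setLIntegral_const, Real.volume_Ioc, rightEnd_eq_add, Data.areaFun, add_sub_cancel_left,
    ENNReal.ofReal_mul (ht.1 i).le, mul_comm]
  congr 2
  ring

theorem Data.objTerm_eq (t : Param n) :
    D.objTerm t = D.stepIntegral t D.objFun / ENNReal.ofReal (area t) := rfl

theorem Data.boxTerm_eq (k : Fin n) (t : Param n) :
    D.boxTerm k t = D.stepIntegral t (D.boxFun k) / ENNReal.ofReal (area t) := by
  unfold Data.boxTerm Data.stepIntegral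
  congr 1
  refine Finset.sum_congr rfl fun i _ => ?_
  have hm : MeasurableSet {x : ℝ | D.x1 k ≤ x ∧ (x : EReal) ≤ D.x2 k} :=
    (measurableSet_le measurable_const measurable_id).inter
      (measurableSet_le measurable_id.coe_real_ereal measurable_const)
  have hset : {x : ℝ | leftEnd t i < x - D.x0 ∧ x - D.x0 ≤ rightEnd t i ∧
      D.x1 k ≤ x ∧ (x : EReal) ≤ D.x2 k} = {x : ℝ | D.x1 k ≤ x ∧ (x : EReal) ≤ D.x2 k} ∩
      Ioc (D.x0 + leftEnd t i) (D.x0 + rightEnd t i) := by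
    ext x
    simp only [mem_ofPred_eq, mem_inter_iff, mem_Ioc]
    constructor
    · rintro ⟨h1, h2, h3⟩
      exact ⟨h3, by linarith, by linarith⟩
    · rintro ⟨h3, h1, h2⟩
      exact ⟨by linarith, by linarith, h3⟩
  rw [hset]
  unfold Data.boxFun
  rw [lintegral_indicator hm (fun _ => (min ((D.y0 + height t i : ℝ) : EReal) (D.y2 k) -
        min ((D.y0 + height t i : ℝ) : EReal) ((D.y1 k : ℝ) : EReal)).toENNReal),
    Measure.restrict_restrict hm]

theorem measurable_leftEnd (i : Fin (steps n)) : Measurable fun t : Param n => leftEnd t i :=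
  Finset.measurable_fun_sum _ fun j _ => (measurable_pi_apply j).comp measurable_fst

theorem measurable_rightEnd (i : Fin (steps n)) : Measurable fun t : Param n => rightEnd t i :=
  Finset.measurable_fun_sum _ fun j _ => (measurable_pi_apply j).comp measurable_fst

theorem measurable_height (i : Fin (steps n)) : Measurable fun t : Param n => height t i :=
  Finset.measurable_fun_sum _ fun j _ => (measurable_pi_apply j).comp measurable_snd

theorem measurable_area : Measurable fun t : Param n => area t :=
  Finset.measurable_fun_sum _ fun i _ => Finset.measurable_fun_sum _ fun j _ =>
    ((measurable_pi_apply i).comp measurable_fst).mul ((measurable_pi_apply j).comp measurable_snd)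

/-- Joint measurability in parameter and point is what Tonelli's theorem needs for mixtures. -/
theorem Data.measurableSet_graph_stepRegion :
    MeasurableSet {r : Param n × (ℝ × ℝ) | r.2 ∈ D.stepRegion r.1} := by
  have hx : Measurable fun r : Param n × (ℝ × ℝ) => r.2.1 := measurable_fst.comp measurable_snd
  have hy : Measurable fun r : Param n × (ℝ × ℝ) => r.2.2 := measurable_snd.comp measurable_snd
  have hr : ∀ i, Measurable fun r : Param n × (ℝ × ℝ) => D.x0 + rightEnd r.1 i := fun i =>
    ((measurable_rightEnd i).comp measurable_fst).const_add _
  have hset : {r : Param n × (ℝ × ℝ) | r.2 ∈ D.stepRegion r.1} =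
      {r | D.y0 ≤ r.2.2} ∩ ⋃ i, ({r | r.2.1 ∈ D.stepInterval r.1 i} ∩
        {r | r.2.2 ≤ D.y0 + height r.1 i}) := by
    ext r
    simp [Data.stepRegion]
  rw [hset]
  refine (measurableSet_le measurable_const hy).inter (MeasurableSet.iUnion fun i => ?_)
  refine MeasurableSet.inter ?_
    (measurableSet_le hy (((measurable_height i).comp measurable_fst).const_add _))
  unfold Data.stepInterval
  split_ifs
  · exact (measurableSet_le measurable_const hx).inter (measurableSet_le hx (hr i))
  · exact (measurableSet_lt (((measurable_leftEnd i).comp measurable_fst).const_add _) hx).inter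
      (measurableSet_le hx (hr i))

theorem Data.measurableSet_stepRegion (t : Param n) : MeasurableSet (D.stepRegion t) :=
  D.measurableSet_graph_stepRegion.preimage measurable_prodMk_left

theorem Data.slice_stepRegion_x0_ne_top (ht : t ∈ admissible n) :
    volume {y | (D.x0, y) ∈ D.stepRegion t} ≠ ∞ := by
  rw [D.slice_stepRegion_x0 ht]
  simp

theorem Data.volume_stepRegion (ht : t ∈ admissible n) :
    volume (D.stepRegion t) = ENNReal.ofReal (area t) := by
  rw [(D.isLower_stepRegion ht).volume_eq (D.measurableSet_stepRegion t).nullMeasurableSet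
    (D.slice_stepRegion_x0_ne_top ht), ← D.stepIntegral_areaFun ht,
    D.stepIntegral_eq ht fun _ _ => D.areaFun_y0]

theorem Data.objTerm_eq_volume (ht : t ∈ admissible n)
    (hg : AEMeasurable D.g (volume.restrict (Ici D.x0)))
    (hgy : ∀ x, D.x0 ≤ x → (D.y0 : EReal) ≤ D.g x) :
    D.objTerm t = (ENNReal.ofReal (area t))⁻¹ * volume (D.stepRegion t ∩ D.rareEvent) := by
  rw [D.objTerm_eq, D.stepIntegral_eq ht fun x hx => Data.objFun_y0 hgy hx.le,
    ← (D.isLower_stepRegion ht).volume_inter_rareEvent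
      (D.measurableSet_stepRegion t).nullMeasurableSet (D.slice_stepRegion_x0_ne_top ht) hg hgy,
    ENNReal.div_eq_inv_mul]

theorem Data.boxTerm_eq_volume (ht : t ∈ admissible n) (k : Fin n) (hy0 : D.y0 ≤ D.y1 k)
    (hy : (D.y1 k : EReal) ≤ D.y2 k) :
    D.boxTerm k t = (ENNReal.ofReal (area t))⁻¹ * volume (D.stepRegion t ∩ D.box k) := by
  rw [D.boxTerm_eq, D.stepIntegral_eq ht fun x _ => D.boxFun_y0 k hy0 hy x,
    ← (D.isLower_stepRegion ht).volume_inter_box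
      (D.measurableSet_stepRegion t).nullMeasurableSet (D.slice_stepRegion_x0_ne_top ht) k hy0 hy,
    ENNReal.div_eq_inv_mul]

end Param

end OUDRO

/-! ### Mixtures of step distributions are feasible densities -/

namespace OUDRO

variable {n : ℕ} (D : Data n)

/-- The density of the uniform distribution on the region under a step function. -/
noncomputable def Data.stepKernel (t : Param n) (q : ℝ × ℝ) : ℝ≥0∞ :=
  (D.stepRegion t).indicator (fun _ => (ENNReal.ofReal (area t))⁻¹) q

theorem Data.measurable_stepKernel :
    Measurable fun r : Param n × (ℝ × ℝ) => D.stepKernel r.1 r.2 := by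
  have hm : Measurable fun r : Param n × (ℝ × ℝ) => (ENNReal.ofReal (area r.1))⁻¹ :=
    (measurable_area.comp measurable_fst).ennreal_ofReal.inv
  exact hm.indicator D.measurableSet_graph_stepRegion

theorem Data.mixDensity_eq (c : ℝ) {Q : Measure (Param n)} (hQ : ∀ᵐ t ∂Q, t ∈ admissible n)
    (q : ℝ × ℝ) : D.mixDensity c Q q = ENNReal.ofReal c * ∫⁻ t, D.stepKernel t q ∂Q := by
  unfold Data.mixDensity Data.stepKernel
  congr 1
  refine lintegral_congr_ae ?_
  filter_upwards [hQ] with t ht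
  rw [D.volume_stepRegion ht]

theorem Data.measurable_mixDensity (c : ℝ) {Q : Measure (Param n)} [SFinite Q]
    (hQ : ∀ᵐ t ∂Q, t ∈ admissible n) : Measurable (D.mixDensity c Q) := by
  rw [show D.mixDensity c Q = _ from funext (D.mixDensity_eq c hQ)]
  exact (D.measurable_stepKernel.lintegral_prod_left' (μ := Q)).const_mul _

/-- The measure `κ` is general because Tonelli's theorem is used both for area restricted to a set
and, for the marginal densities, for length on the two boundary lines. -/
theorem Data.lintegral_mixDensity (c : ℝ) {Q : Measure (Param n)} [SFinite Q]
    (hQ : ∀ᵐ t ∂Q, t ∈ admissible n) (κ : Measure (ℝ × ℝ)) [SFinite κ] :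
    ∫⁻ q, D.mixDensity c Q q ∂κ =
      ENNReal.ofReal c * ∫⁻ t, (ENNReal.ofReal (area t))⁻¹ * κ (D.stepRegion t) ∂Q := by
  simp_rw [D.mixDensity_eq c hQ]
  rw [lintegral_const_mul' _ _ ENNReal.ofReal_ne_top, lintegral_lintegral_swap]
  · congr 1
    refine lintegral_congr fun t => ?_
    exact lintegral_indicator_const (D.measurableSet_stepRegion t) _
  · exact (D.measurable_stepKernel.comp measurable_swap).aemeasurable

theorem Data.dist_mixDensity (c : ℝ) {Q : Measure (Param n)} [SFinite Q]
    (hQ : ∀ᵐ t ∂Q, t ∈ admissible n) {B : Set (ℝ × ℝ)} (hB : NullMeasurableSet B volume) :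
    D.dist (D.mixDensity c Q) B = ENNReal.ofReal c *
      ∫⁻ t, (ENNReal.ofReal (area t))⁻¹ * volume (D.stepRegion t ∩ B) ∂Q := by
  rw [Data.dist, withDensity_apply₀ _ (hB.mono_ac Measure.restrict_le_self.absolutelyContinuous),
    D.lintegral_mixDensity c hQ]
  congr 1
  refine lintegral_congr_ae ?_
  filter_upwards [hQ] with t ht
  rw [Measure.restrict_apply (D.measurableSet_stepRegion t), Measure.restrict_apply₀,
    inter_eq_left.2 (inter_subset_left.trans (D.isLower_stepRegion ht).subset_tail)]
  exact ((D.measurableSet_stepRegion t).nullMeasurableSet.inter hB).mono_ac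
    Measure.restrict_le_self.absolutelyContinuous

theorem Data.isStepMixture_mixDensity (c : ℝ) {Q : Measure (Param n)} [SFinite Q]
    (hQ : ∀ᵐ t ∂Q, t ∈ admissible n) : D.IsStepMixture (D.dist (D.mixDensity c Q)) c Q := by
  intro B hB
  rw [D.dist_mixDensity c hQ hB.nullMeasurableSet]
  congr 1
  refine lintegral_congr_ae ?_
  filter_upwards [hQ] with t ht
  rw [Data.stepUniform, ProbabilityTheory.cond_apply (D.measurableSet_stepRegion t),
    D.volume_stepRegion ht]

theorem Data.tailProb_mixDensity (c : ℝ) {Q : Measure (Param n)} [IsProbabilityMeasure Q]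
    (hQ : ∀ᵐ t ∂Q, t ∈ admissible n) : D.tailProb (D.mixDensity c Q) = ENNReal.ofReal c := by
  rw [Data.tailProb, D.dist_mixDensity c hQ D.measurableSet_tail.nullMeasurableSet]
  rw [lintegral_congr_ae (g := fun _ => 1)]
  · simp
  · filter_upwards [hQ] with t ht
    rw [inter_eq_left.2 (D.isLower_stepRegion ht).subset_tail, D.volume_stepRegion ht]
    exact ENNReal.inv_mul_cancel (by simpa using area_pos ht) ENNReal.ofReal_ne_top

theorem Data.ouObj_mixDensity (c : ℝ) {Q : Measure (Param n)} [SFinite Q]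
    (hQ : ∀ᵐ t ∂Q, t ∈ admissible n) (hg : AEMeasurable D.g (volume.restrict (Ici D.x0)))
    (hgy : ∀ x, D.x0 ≤ x → (D.y0 : EReal) ≤ D.g x) :
    D.ouObj (D.mixDensity c Q) = D.momentObj c Q := by
  rw [Data.ouObj, Data.momentObj, D.dist_mixDensity c hQ (Data.nullMeasurableSet_rareEvent hg)]
  congr 1
  refine lintegral_congr_ae ?_
  filter_upwards [hQ] with t ht
  rw [D.objTerm_eq_volume ht hg hgy]

theorem Data.dist_mixDensity_box (c : ℝ) {Q : Measure (Param n)} [SFinite Q]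
    (hQ : ∀ᵐ t ∂Q, t ∈ admissible n) (k : Fin n) (hy0 : D.y0 ≤ D.y1 k)
    (hy : (D.y1 k : EReal) ≤ D.y2 k) :
    D.dist (D.mixDensity c Q) (D.box k) = ENNReal.ofReal c * ∫⁻ t, D.boxTerm k t ∂Q := by
  rw [D.dist_mixDensity c hQ (D.measurableSet_box k).nullMeasurableSet]
  congr 1
  refine lintegral_congr_ae ?_
  filter_upwards [hQ] with t ht
  rw [D.boxTerm_eq_volume ht k hy0 hy]

theorem Data.marginalX_mixDensity (c : ℝ) {Q : Measure (Param n)} [SFinite Q]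
    (hQ : ∀ᵐ t ∂Q, t ∈ admissible n) :
    ∫⁻ y in Ici D.y0, D.mixDensity c Q (D.x0, y) = ENNReal.ofReal c * ∫⁻ t, xTerm t ∂Q := by
  have hm : Measurable fun y : ℝ => (D.x0, y) := measurable_prodMk_left
  have h1 := D.lintegral_mixDensity c hQ ((volume.restrict (Ici D.y0)).map fun y => (D.x0, y))
  rw [lintegral_map (D.measurable_mixDensity c hQ) hm] at h1
  rw [h1]
  congr 1
  refine lintegral_congr_ae ?_
  filter_upwards [hQ] with t ht
  rw [Measure.map_apply hm (D.measurableSet_stepRegion t)]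
  change _ * (volume.restrict (Ici D.y0)) {y | (D.x0, y) ∈ D.stepRegion t} = _
  rw [D.slice_stepRegion_x0 ht, Measure.restrict_apply measurableSet_Icc,
    inter_eq_left.2 Icc_subset_Ici_self, Real.volume_Icc, add_sub_cancel_left, xTerm,
    ENNReal.div_eq_inv_mul]

theorem Data.marginalY_mixDensity (c : ℝ) {Q : Measure (Param n)} [SFinite Q]
    (hQ : ∀ᵐ t ∂Q, t ∈ admissible n) :
    ∫⁻ x in Ici D.x0, D.mixDensity c Q (x, D.y0) = ENNReal.ofReal c * ∫⁻ t, yTerm t ∂Q := by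
  have hm : Measurable fun x : ℝ => (x, D.y0) := measurable_prodMk_right
  have h1 := D.lintegral_mixDensity c hQ ((volume.restrict (Ici D.x0)).map fun x => (x, D.y0))
  rw [lintegral_map (D.measurable_mixDensity c hQ) hm] at h1
  rw [h1]
  congr 1
  refine lintegral_congr_ae ?_
  filter_upwards [hQ] with t ht
  rw [Measure.map_apply hm (D.measurableSet_stepRegion t)]
  change _ * (volume.restrict (Ici D.x0)) {x | (x, D.y0) ∈ D.stepRegion t} = _
  rw [D.slice_stepRegion_y0 ht, Measure.restrict_apply measurableSet_Icc,
    inter_eq_left.2 Icc_subset_Ici_self, Real.volume_Icc, add_sub_cancel_left, yTerm,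
    ENNReal.div_eq_inv_mul]

theorem ofReal_mul_ofReal_div {c u : ℝ} (hc : 0 < c) :
    ENNReal.ofReal c * ENNReal.ofReal (u / c) = ENNReal.ofReal u := by
  rw [← ENNReal.ofReal_mul hc.le, mul_div_cancel₀ _ hc.ne']

theorem Data.mixDensity_mem_ouFeasible {c : ℝ} (hc : 0 < c) {Q : Measure (Param n)}
    (hQ : Q ∈ D.momentFeasible c) (hy0 : ∀ k, D.y0 ≤ D.y1 k)
    (hy : ∀ k, (D.y1 k : EReal) ≤ D.y2 k) : D.mixDensity c Q ∈ D.ouFeasible c := by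
  obtain ⟨hprob, hadm, hX, hY, hbox⟩ := hQ
  have htail := D.tailProb_mixDensity c hadm
  refine ⟨⟨(D.measurable_mixDensity c hadm).aemeasurable, ?_, ?_, fun k => ?_, fun k => ?_, ?_⟩,
    htail⟩
  · rw [D.marginalX_mixDensity c hadm, ← ofReal_mul_ofReal_div (u := D.uX) hc]
    gcongr
  · rw [D.marginalY_mixDensity c hadm, ← ofReal_mul_ofReal_div (u := D.uY) hc]
    gcongr
  · rw [htail, D.dist_mixDensity_box c hadm k (hy0 k) (hy k), mul_comm]
    gcongr
    exact (hbox k).1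
  · rw [htail, D.dist_mixDensity_box c hadm k (hy0 k) (hy k), mul_comm]
    gcongr
    exact (hbox k).2
  -- Each kernel is a constant times the indicator of a lower region, and orthounimodality passes to
  -- mixtures.
  · intro x' x y' y hx' hxx' hy' hyy'
    rw [D.mixDensity_eq c hadm, D.mixDensity_eq c hadm]
    gcongr ENNReal.ofReal c * ?_
    refine lintegral_mono_ae ?_
    filter_upwards [hadm] with t ht
    unfold Data.stepKernel
    by_cases h : (x, y) ∈ D.stepRegion t
    · rw [indicator_of_mem h,
        indicator_of_mem ((D.isLower_stepRegion ht).mem_of_le h hx' hxx' hy' hyy')]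
    · rw [indicator_of_notMem h]
      exact zero_le

theorem Vars.ae_discrete {v : Vars n} {P : Param n → Prop} (h : ∀ l, P (v.pt l)) :
    ∀ᵐ t ∂v.discrete, P t := by
  rw [Vars.discrete, ae_iff, Measure.finsetSum_apply]
  refine Finset.sum_eq_zero fun l _ => ?_
  rw [Measure.smul_apply, smul_eq_mul]
  have : ∀ᵐ t ∂(Measure.dirac (v.pt l)), P t := by
    rw [ae_dirac_eq]
    exact h l
  rw [ae_iff.1 this, mul_zero]

theorem Vars.lintegral_discrete (v : Vars n) (F : Param n → ℝ≥0∞) :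
    ∫⁻ t, F t ∂v.discrete = ∑ l, ENNReal.ofReal (v.p l) * F (v.pt l) := by
  rw [Vars.discrete, lintegral_finsetSum_measure]
  refine Finset.sum_congr rfl fun l _ => ?_
  rw [lintegral_smul_measure, lintegral_dirac, smul_eq_mul]

variable {D}

theorem Data.pt_admissible {c : ℝ} {v : Vars n} (hv : v ∈ D.nlpFeasible c) (l : Fin (n + 3)) :
    v.pt l ∈ admissible n := by
  obtain ⟨_, _, _, _, _, hw0, hw, hz⟩ := hv
  exact ⟨hz l, hw0 l, hw l⟩

theorem Data.discrete_mem_momentFeasible {c : ℝ} {v : Vars n} (hv : v ∈ D.nlpFeasible c) :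
    v.discrete ∈ D.momentFeasible c := by
  have hadm := Vars.ae_discrete (Data.pt_admissible hv)
  obtain ⟨hX, hY, hbox, hp1, hp, -⟩ := hv
  refine ⟨⟨?_⟩, hadm, ?_, ?_, fun k => ?_⟩
  · have := v.lintegral_discrete 1
    simp only [Pi.one_apply, lintegral_one, mul_one] at this
    rw [this, ← ENNReal.ofReal_sum_of_nonneg fun l _ => hp l, hp1, ENNReal.ofReal_one]
  · rwa [v.lintegral_discrete]
  · rwa [v.lintegral_discrete]
  · rw [v.lintegral_discrete]
    exact hbox k

theorem Data.momentObj_discrete (D : Data n) (c : ℝ) (v : Vars n) :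
    D.momentObj c v.discrete = D.nlpObj c v := by
  rw [Data.momentObj, Data.nlpObj, v.lintegral_discrete]

/-- With finitely many atoms the density is a finite sum of finite constants. For a general mixing
law, small regions may accumulate and make it infinite at the mode. -/
theorem Data.mixDensity_discrete_mem_realValued {c : ℝ} {v : Vars n} (hv : v ∈ D.nlpFeasible c) :
    D.mixDensity c v.discrete ∈ D.realValued := by
  intro q _
  rw [D.mixDensity_eq c (Vars.ae_discrete (Data.pt_admissible hv)), v.lintegral_discrete]
  refine ENNReal.mul_ne_top ENNReal.ofReal_ne_top (ENNReal.sum_ne_top.2 fun l _ =>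
    ENNReal.mul_ne_top ENNReal.ofReal_ne_top ?_)
  have h0 : ENNReal.ofReal (area (v.pt l)) ≠ 0 := by
    simpa using area_pos (Data.pt_admissible hv l)
  unfold Data.stepKernel
  by_cases h : q ∈ D.stepRegion (v.pt l)
  · rw [indicator_of_mem h]
    exact ENNReal.inv_ne_top.2 h0
  · rw [indicator_of_notMem h]
    exact ENNReal.zero_ne_top

end OUDRO

/-! ### From a feasible density to a feasible point of the nonlinear program -/

/-- The layer cake formula for an integrable function with values in `[0, ∞]`. -/
theorem lintegral_eq_lintegral_meas_ofReal_lt {Ω : Type*} [MeasurableSpace Ω] (κ : Measure Ω)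
    {f : Ω → ℝ≥0∞} (hf : AEMeasurable f κ) (hfi : ∫⁻ x, f x ∂κ ≠ ∞) :
    ∫⁻ x, f x ∂κ = ∫⁻ s in Ioi (0 : ℝ), κ {x | ENNReal.ofReal s < f x} := by
  have hfin := ae_lt_top' hf hfi
  calc ∫⁻ x, f x ∂κ = ∫⁻ x, ENNReal.ofReal (f x).toReal ∂κ := by
        refine lintegral_congr_ae ?_
        filter_upwards [hfin] with x hx
        rw [ENNReal.ofReal_toReal hx.ne]
    _ = ∫⁻ s in Ioi (0 : ℝ), κ {x | s < (f x).toReal} :=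
        lintegral_eq_lintegral_meas_lt κ (Filter.Eventually.of_forall fun _ =>
          ENNReal.toReal_nonneg) hf.ennreal_toReal
    _ = ∫⁻ s in Ioi (0 : ℝ), κ {x | ENNReal.ofReal s < f x} := by
        refine setLIntegral_congr_fun measurableSet_Ioi fun s hs => measure_congr ?_
        filter_upwards [hfin] with x hx
        exact propext (ENNReal.ofReal_lt_iff_lt_toReal (le_of_lt hs) hx.ne).symm

namespace OUDRO

variable {n : ℕ} {D : Data n}

/-- The uniform distribution on an orthounimodal region can be replaced by the uniform distribution
on the region under a step function. -/
theorem Data.IsLower.exists_step {R : Set (ℝ × ℝ)} (hR : D.IsLower R)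
    (hRm : NullMeasurableSet R volume) (hpos : volume R ≠ 0)
    (hheight : volume {y | (D.x0, y) ∈ R} ≠ ∞) (hwidth : volume {x | (x, D.y0) ∈ R} ≠ ∞)
    (hg : AEMeasurable D.g (volume.restrict (Ici D.x0)))
    (hgy : ∀ x, D.x0 ≤ x → (D.y0 : EReal) ≤ D.g x)
    (hx : ∀ k, (D.x1 k : EReal) ≤ D.x2 k) (hy0 : ∀ k, D.y0 ≤ D.y1 k)
    (hy : ∀ k, (D.y1 k : EReal) ≤ D.y2 k) :
    ∃ t ∈ admissible n, xTerm t ≤ volume {y | (D.x0, y) ∈ R} / volume R ∧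
      yTerm t ≤ volume {x | (x, D.y0) ∈ R} / volume R ∧
      (∀ k, D.boxTerm k t = volume (R ∩ D.box k) / volume R) ∧
      volume (R ∩ D.rareEvent) / volume R ≤ D.objTerm t := by
  -- Beyond the width of its bottom slice the region is empty, so only the bounded interval from
  -- `x0` to `b` matters.
  set b := D.x0 + (volume {x | (x, D.y0) ∈ R}).toReal with hb
  have hxb : D.x0 ≤ b := le_add_of_nonneg_right ENNReal.toReal_nonneg
  have htr : ∀ F : ℝ → ℝ → ℝ≥0∞, (∀ x, D.x0 < x → F x D.y0 = 0) →
      ∫⁻ x in Ici D.x0, F x (D.top R x) = ∫⁻ x in Ioo D.x0 b, F x (D.top R x) := by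
    intro F hF
    have hzero : ∀ x ∈ Ioi b, F x (D.top R x) = 0 := fun x hxb' => by
      rw [hR.top_eq_of_lt hwidth hxb', hF x (hxb.trans_lt hxb')]
    rw [← setLIntegral_congr (Ioi_ae_eq_Ici (a := D.x0)), ← Ioc_union_Ioi_eq_Ioi hxb,
      lintegral_union measurableSet_Ioi (by
        rw [Set.disjoint_left]; exact fun x hx hx' => hx.2.not_gt hx'),
      setLIntegral_congr_fun measurableSet_Ioi hzero, lintegral_zero, add_zero,
      setLIntegral_congr (Ioo_ae_eq_Ioc (a := D.x0) (b := b))]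
  have hvol : volume R = ∫⁻ x in Ioo D.x0 b, D.areaFun (D.top R x) := by
    rw [hR.volume_eq hRm hheight, htr (fun _ v => D.areaFun v) fun _ _ => D.areaFun_y0]
  have hlt : D.x0 < b := by
    refine lt_of_le_of_ne hxb fun h => hpos ?_
    rw [hvol, ← h]
    simp
  have hsub : Ioo D.x0 b ⊆ Ici D.x0 := fun x hx => hx.1.le
  have hanti := hR.antitoneOn_top hheight
  have hM : ∀ x ∈ Ioo D.x0 b, D.top R x ≤ D.top R D.x0 := fun x hx =>
    hanti self_mem_Ici (hsub hx) hx.1.le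
  obtain ⟨m, hm, h', B, hB, ha', hM', hm', hs', hA', hbox', ho'⟩ := Data.exists_replaceable hy hx hlt
    (hanti.mono hsub) (fun x _ => D.le_top R x)
    ⟨D.top R D.x0, by rintro _ ⟨x, hx, rfl⟩; exact hM x hx⟩
    (hg.mono_measure (Measure.restrict_mono hsub le_rfl))
  -- With `m ≤ 4 n + 1` pieces there are at most `3 m - 1 ≤ 12 n + 2` jumps, one less than the
  -- number of steps.
  obtain ⟨t, ht, hw, hz, hF⟩ := D.exists_admissible ha' (hm' _ fun x _ => D.le_top R x)
    (hM' _ hM) hs' (by unfold steps; omega) (by rw [hA', ← hvol]; exact hpos)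
  have harea : ENNReal.ofReal (area t) = volume R := by
    rw [← D.stepIntegral_areaFun ht, hF _ fun _ _ => D.areaFun_y0, hA', hvol]
  refine ⟨t, ht, ?_, ?_, fun k => ?_, ?_⟩
  · rw [xTerm, harea]
    gcongr
    rw [Data.top, add_sub_cancel_left] at hw
    exact (ENNReal.ofReal_le_ofReal hw).trans_eq (ENNReal.ofReal_toReal hheight)
  · rw [yTerm, harea]
    gcongr
    rw [hb, add_sub_cancel_left] at hz
    exact (ENNReal.ofReal_le_ofReal hz).trans_eq (ENNReal.ofReal_toReal hwidth)
  · have h0 := fun x (_ : D.x0 < x) => D.boxFun_y0 k (hy0 k) (hy k) x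
    rw [D.boxTerm_eq, harea, hF _ h0, hbox' k, ← htr _ h0,
      hR.volume_inter_box hRm hheight k (hy0 k) (hy k)]
  · have h0 := fun x (hx : D.x0 < x) => Data.objFun_y0 hgy hx.le
    rw [D.objTerm_eq, harea, hF _ h0, hR.volume_inter_rareEvent hRm hheight hg hgy, htr _ h0]
    gcongr

/-- The superlevel set of a density at level `s`. -/
def Data.superlevel (D : Data n) (f : ℝ × ℝ → ℝ≥0∞) (s : ℝ) : Set (ℝ × ℝ) :=
  {q | ENNReal.ofReal s < f q} ∩ D.tail

theorem Data.superlevel_anti (D : Data n) (f : ℝ × ℝ → ℝ≥0∞) {s s' : ℝ} (hs : s ≤ s') :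
    D.superlevel f s' ⊆ D.superlevel f s := fun _ hq =>
  ⟨(ENNReal.ofReal_le_ofReal hs).trans_lt hq.1, hq.2⟩

theorem Data.IsOU.isLower {f : ℝ × ℝ → ℝ≥0∞} (hf : D.IsOU f) (s : ℝ) :
    D.IsLower (D.superlevel f s) where
  subset_tail := inter_subset_right
  mem_of_le := fun h hx' hx hy' hy =>
    ⟨lt_of_lt_of_le h.1 (hf.orthounimodal _ _ _ _ hx' hx hy' hy), hx', hy'⟩

theorem Data.IsOU.nullMeasurableSet {f : ℝ × ℝ → ℝ≥0∞} (hf : D.IsOU f) (s : ℝ) :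
    NullMeasurableSet (D.superlevel f s) volume :=
  (nullMeasurableSet_restrict D.measurableSet_tail.nullMeasurableSet).1
    (nullMeasurableSet_lt aemeasurable_const hf.measurable)

theorem Data.IsOU.dist_eq {f : ℝ × ℝ → ℝ≥0∞} (hf : D.IsOU f) (hfin : D.tailProb f ≠ ∞)
    {B : Set (ℝ × ℝ)} (hB : NullMeasurableSet B volume) :
    D.dist f B = ∫⁻ s in Ioi (0 : ℝ), volume (D.superlevel f s ∩ B) := by
  have hB' : NullMeasurableSet B (volume.restrict D.tail) :=
    hB.mono_ac Measure.restrict_le_self.absolutelyContinuous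
  have hdist : D.dist f B = ∫⁻ q in B, f q ∂(volume.restrict D.tail) := withDensity_apply₀ _ hB'
  have htail : D.tailProb f = ∫⁻ q, f q ∂(volume.restrict D.tail) := by
    rw [Data.tailProb, Data.dist, withDensity_apply _ D.measurableSet_tail,
      Measure.restrict_restrict D.measurableSet_tail, inter_self]
  rw [hdist, lintegral_eq_lintegral_meas_ofReal_lt _ hf.measurable.restrict
    (ne_top_of_le_ne_top (htail ▸ hfin) (setLIntegral_le_lintegral _ _))]
  refine lintegral_congr fun s => ?_
  rw [Measure.restrict_apply₀' hB', Measure.restrict_apply' D.measurableSet_tail, inter_right_comm]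
  rfl

/-- Almost everywhere measurability in the plane says nothing on this null line; measurability there
comes from monotonicity, and integrability from the marginal bound. -/
theorem Data.IsOU.marginalX_eq {f : ℝ × ℝ → ℝ≥0∞} (hf : D.IsOU f) :
    ∫⁻ y in Ici D.y0, f (D.x0, y) =
      ∫⁻ s in Ioi (0 : ℝ), volume {y | (D.x0, y) ∈ D.superlevel f s} := by
  have hanti : AntitoneOn (fun y => f (D.x0, y)) (Ici D.y0) := fun y hy y' _ hyy' =>
    hf.orthounimodal _ _ _ _ le_rfl le_rfl hy hyy'
  rw [lintegral_eq_lintegral_meas_ofReal_lt _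
    (aemeasurable_restrict_of_antitoneOn measurableSet_Ici hanti)
    (ne_top_of_le_ne_top ENNReal.ofReal_ne_top hf.marginalX)]
  refine lintegral_congr fun s => ?_
  rw [Measure.restrict_apply' measurableSet_Ici]
  congr 1
  ext y
  exact and_congr_right fun _ => (and_iff_right le_rfl).symm

theorem Data.IsOU.marginalY_eq {f : ℝ × ℝ → ℝ≥0∞} (hf : D.IsOU f) :
    ∫⁻ x in Ici D.x0, f (x, D.y0) =
      ∫⁻ s in Ioi (0 : ℝ), volume {x | (x, D.y0) ∈ D.superlevel f s} := by
  have hanti : AntitoneOn (fun x => f (x, D.y0)) (Ici D.x0) := fun x hx x' _ hxx' =>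
    hf.orthounimodal _ _ _ _ hx hxx' le_rfl le_rfl
  rw [lintegral_eq_lintegral_meas_ofReal_lt _
    (aemeasurable_restrict_of_antitoneOn measurableSet_Ici hanti)
    (ne_top_of_le_ne_top ENNReal.ofReal_ne_top hf.marginalY)]
  refine lintegral_congr fun s => ?_
  rw [Measure.restrict_apply' measurableSet_Ici]
  congr 1
  ext x
  exact and_congr_right fun _ => (and_iff_left le_rfl).symm

/-- Every feasible density is dominated by a feasible point of the nonlinear program. -/
theorem Data.exists_nlpFeasible {c : ℝ} (hc : 0 < c) {f : ℝ × ℝ → ℝ≥0∞} (hf : f ∈ D.ouFeasible c)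
    (hg : AEMeasurable D.g (volume.restrict (Ici D.x0)))
    (hgy : ∀ x, D.x0 ≤ x → (D.y0 : EReal) ≤ D.g x)
    (hx : ∀ k, (D.x1 k : EReal) ≤ D.x2 k) (hy0 : ∀ k, D.y0 ≤ D.y1 k)
    (hy : ∀ k, (D.y1 k : EReal) ≤ D.y2 k) :
    ∃ v ∈ D.nlpFeasible c, D.ouObj f ≤ D.nlpObj c v := by
  obtain ⟨hOU, hmass⟩ := hf
  have hfin : D.tailProb f ≠ ∞ := hmass ▸ ENNReal.ofReal_ne_top
  have hc0 : ENNReal.ofReal c ≠ 0 := by simpa using hc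
  have hct : ENNReal.ofReal c ≠ ∞ := ENNReal.ofReal_ne_top
  let V : ℝ → ℝ≥0∞ := fun s => volume (D.superlevel f s)
  let X : ℝ → ℝ≥0∞ := fun s => volume {y | (D.x0, y) ∈ D.superlevel f s}
  let Y : ℝ → ℝ≥0∞ := fun s => volume {x | (x, D.y0) ∈ D.superlevel f s}
  let I : Set (ℝ × ℝ) → ℝ → ℝ≥0∞ := fun B s => volume (D.superlevel f s ∩ B)
  have hVm : Measurable V := Antitone.measurable fun s s' h =>
    measure_mono (D.superlevel_anti f h)
  have hXm : Measurable X := Antitone.measurable fun s s' h =>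
    measure_mono fun y hy => D.superlevel_anti f h hy
  have hYm : Measurable Y := Antitone.measurable fun s s' h =>
    measure_mono fun y hy => D.superlevel_anti f h hy
  have hIm : ∀ B, Measurable (I B) := fun B => Antitone.measurable fun s s' h =>
    measure_mono (inter_subset_inter_left _ (D.superlevel_anti f h))
  have hV : ∫⁻ s in Ioi (0 : ℝ), V s = ENNReal.ofReal c := by
    rw [← hmass, Data.tailProb, hOU.dist_eq hfin D.measurableSet_tail.nullMeasurableSet]
    refine lintegral_congr fun s => ?_
    rw [inter_eq_left.2 (hOU.isLower s).subset_tail]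
  have hXi : ∫⁻ s in Ioi (0 : ℝ), X s ≤ ENNReal.ofReal D.uX :=
    hOU.marginalX_eq.symm.trans_le hOU.marginalX
  have hYi : ∫⁻ s in Ioi (0 : ℝ), Y s ≤ ENNReal.ofReal D.uY :=
    hOU.marginalY_eq.symm.trans_le hOU.marginalY
  -- The mixing law of the level: the uniform law on a superlevel set is weighted by the area of
  -- that set.
  let ρ : ℝ → ℝ≥0∞ := fun s => (ENNReal.ofReal c)⁻¹ * V s
  have hρ : Measurable ρ := hVm.const_mul _
  let μ : Measure ℝ := (volume.restrict (Ioi 0)).withDensity ρ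
  have hμ : IsProbabilityMeasure μ := ⟨by
    rw [withDensity_apply _ MeasurableSet.univ, Measure.restrict_univ,
      lintegral_const_mul _ hVm, hV, ENNReal.inv_mul_cancel hc0 hct]⟩
  have hVfin : ∀ᵐ s ∂(volume.restrict (Ioi (0 : ℝ))), V s < ∞ :=
    ae_lt_top hVm (hV ▸ hct)
  have hwd : ∀ A : ℝ → ℝ≥0∞, Measurable A → ∫⁻ s, A s / V s ∂μ =
      ∫⁻ s in Ioi (0 : ℝ), ρ s * (A s / V s) := fun A hA =>
    lintegral_withDensity_eq_lintegral_mul _ hρ (hA.div hVm)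
  -- Only an inequality, because a superlevel set may have area zero but a slice of positive length.
  -- It suffices for the marginals, which are bounded from above only; areas `I B` are dominated by
  -- `V` and give equality.
  have hle : ∀ A : ℝ → ℝ≥0∞, Measurable A → ∫⁻ s, A s / V s ∂μ ≤
      (ENNReal.ofReal c)⁻¹ * ∫⁻ s in Ioi (0 : ℝ), A s := by
    intro A hA
    rw [hwd A hA, ← lintegral_const_mul _ hA]
    refine lintegral_mono fun s => ?_
    simp only [ρ, mul_assoc]
    gcongr
    exact ENNReal.mul_div_le
  have heq : ∀ B, ∫⁻ s, I B s / V s ∂μ =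
      (ENNReal.ofReal c)⁻¹ * ∫⁻ s in Ioi (0 : ℝ), I B s := by
    intro B
    rw [hwd _ (hIm B), ← lintegral_const_mul _ (hIm B)]
    refine lintegral_congr_ae ?_
    filter_upwards [hVfin] with s hs
    simp only [ρ, mul_assoc]
    congr 1
    rcases eq_or_ne (V s) 0 with h0 | h0
    · rw [h0, zero_mul]
      exact (measure_mono_null inter_subset_left h0).symm
    · exact ENNReal.mul_div_cancel h0 hs.ne
  have hIbound : ∀ B, ∫⁻ s, I B s / V s ∂μ ≠ ∞ := by
    intro B
    refine ne_top_of_le_ne_top ?_ (hle _ (hIm B))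
    refine ENNReal.mul_ne_top (ENNReal.inv_ne_top.2 hc0) (ne_top_of_le_ne_top (hV ▸ hct) ?_)
    exact lintegral_mono fun s => measure_mono inter_subset_left
  have hinv : ∀ u, (ENNReal.ofReal c)⁻¹ * ENNReal.ofReal u = ENNReal.ofReal (u / c) := fun u => by
    rw [ENNReal.ofReal_div_of_pos hc, ENNReal.div_eq_inv_mul]
  have hXμ : ∫⁻ s, X s / V s ∂μ ≤ ENNReal.ofReal (D.uX / c) := by
    rw [← hinv]
    exact (hle _ hXm).trans (by gcongr)
  have hYμ : ∫⁻ s, Y s / V s ∂μ ≤ ENNReal.ofReal (D.uY / c) := by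
    rw [← hinv]
    exact (hle _ hYm).trans (by gcongr)
  -- Two marginals and `n` boxes are the `n + 2` fixed means, whence `n + 3` atoms.
  let u : Fin (n + 2) → ℝ → ℝ≥0∞ :=
    Fin.cons (fun s => X s / V s) (Fin.cons (fun s => Y s / V s) fun k s => I (D.box k) s / V s)
  -- The atoms must be levels whose region has positive area, finite height and finite width, as the
  -- replacement by a step region demands.
  have hS : ∀ᵐ s ∂μ, s ∈ {s | V s ≠ 0 ∧ X s ≠ ∞ ∧ Y s ≠ ∞} := by
    refine (ae_withDensity_iff hρ).2 ?_
    filter_upwards [ae_lt_top hXm (ne_top_of_le_ne_top ENNReal.ofReal_ne_top hXi),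
      ae_lt_top hYm (ne_top_of_le_ne_top ENNReal.ofReal_ne_top hYi)] with s h1 h2 h3
    exact ⟨right_ne_zero_of_mul h3, h1.ne, h2.ne⟩
  obtain ⟨p, s, hp, hp1, hs, hpu, hpG⟩ := exists_discrete_of_lintegral μ u
    (fun s => I D.rareEvent s / V s)
    (fun j => by
      refine Fin.cases ?_ (fun j => Fin.cases ?_ (fun k => ?_) j) j
      · exact (hXm.div hVm).aemeasurable
      · exact (hYm.div hVm).aemeasurable
      · exact ((hIm _).div hVm).aemeasurable)
    ((hIm _).div hVm).aemeasurable
    (fun j => by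
      refine Fin.cases ?_ (fun j => Fin.cases ?_ (fun k => ?_) j) j
      · exact ne_top_of_le_ne_top ENNReal.ofReal_ne_top hXμ
      · exact ne_top_of_le_ne_top ENNReal.ofReal_ne_top hYμ
      · exact hIbound _)
    (hIbound _) hS
  choose t ht hXt hYt hbox hobj using fun l => (hOU.isLower (s l)).exists_step
    (hOU.nullMeasurableSet (s l)) (hs l).1 (hs l).2.1 (hs l).2.2 hg hgy hx hy0 hy
  have hX' : ∑ l, ENNReal.ofReal (p l) * (X (s l) / V (s l)) = ∫⁻ s, X s / V s ∂μ := hpu 0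
  have hY' : ∑ l, ENNReal.ofReal (p l) * (Y (s l) / V (s l)) = ∫⁻ s, Y s / V s ∂μ := hpu 1
  have hB' : ∀ k, ∑ l, ENNReal.ofReal (p l) * D.boxTerm k (t l) =
      (ENNReal.ofReal c)⁻¹ * D.dist f (D.box k) := by
    intro k
    rw [hOU.dist_eq hfin (D.measurableSet_box k).nullMeasurableSet]
    refine Eq.trans ?_ ((hpu k.succ.succ).trans (heq (D.box k)))
    exact Finset.sum_congr rfl fun l _ => by rw [hbox l k]; rfl
  refine ⟨⟨p, fun l => (t l).1, fun l => (t l).2⟩, ⟨?_, ?_, fun k => ?_, hp1, hp,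
    fun l => (ht l).2.1, fun l => (ht l).2.2, fun l => (ht l).1⟩, ?_⟩
  · refine le_trans (Finset.sum_le_sum fun l _ => ?_) (hX'.trans_le hXμ)
    exact mul_le_mul_right (hXt l) _
  · refine le_trans (Finset.sum_le_sum fun l _ => ?_) (hY'.trans_le hYμ)
    exact mul_le_mul_right (hYt l) _
  · change _ ≤ ∑ l, ENNReal.ofReal (p l) * D.boxTerm k (t l) ∧
      ∑ l, ENNReal.ofReal (p l) * D.boxTerm k (t l) ≤ _
    have hlow := hOU.lower k
    have hupp := hOU.upper k
    rw [hmass] at hlow hupp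
    rw [hB', ← ENNReal.div_eq_inv_mul]
    exact ⟨(ENNReal.le_div_iff_mul_le (Or.inl hc0) (Or.inl hct)).2 hlow,
      ENNReal.div_le_of_le_mul hupp⟩
  · change D.dist f D.rareEvent ≤ ENNReal.ofReal c *
      ∑ l, ENNReal.ofReal (p l) * D.objTerm (t l)
    calc D.dist f D.rareEvent
        = ENNReal.ofReal c * ∫⁻ s, I D.rareEvent s / V s ∂μ := by
          rw [heq, ← mul_assoc, ENNReal.mul_inv_cancel hc0 hct, one_mul,
            hOU.dist_eq hfin (Data.nullMeasurableSet_rareEvent hg)]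
      _ ≤ _ := by
          refine mul_le_mul_right (hpG.trans (Finset.sum_le_sum fun l _ => ?_)) _
          exact mul_le_mul_right (hobj l) _

end OUDRO

/-! ### Comparison of the optimal values -/

namespace OUDRO

theorem optValue_le_optValue {α β : Type} {S : Set α} {S' : Set β} {o : α → ℝ≥0∞} {o' : β → ℝ≥0∞}
    (h : ∀ v ∈ S, ∃ v' ∈ S', o v ≤ o' v') : optValue S o ≤ optValue S' o' := by
  refine iSup₂_le fun v hv => ?_
  obtain ⟨v', hv', hle⟩ := h v hv
  exact (EReal.coe_ennreal_le_coe_ennreal_iff.2 hle).trans (le_iSup₂_of_le v' hv' le_rfl)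

variable {n : ℕ} {D : Data n}

/-- A density whose tail probability lies in `[l, u]` is dominated by a feasible point of the
nonlinear program in which the tail probability is a decision variable. -/
theorem Data.exists_nlpFeasibleRange {l u : ℝ} (hl : 0 ≤ l) (hlu : l ≤ u)
    (hne : 0 < l ∨ (D.nlpFeasibleRange l u).Nonempty) {f : ℝ × ℝ → ℝ≥0∞}
    (hf : f ∈ D.ouFeasibleRange l u) (hg : AEMeasurable D.g (volume.restrict (Ici D.x0)))
    (hgy : ∀ x, D.x0 ≤ x → (D.y0 : EReal) ≤ D.g x)
    (hx : ∀ k, (D.x1 k : EReal) ≤ D.x2 k) (hy0 : ∀ k, D.y0 ≤ D.y1 k)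
    (hy : ∀ k, (D.y1 k : EReal) ≤ D.y2 k) :
    ∃ cv ∈ D.nlpFeasibleRange l u, D.ouObj f ≤ D.nlpObjRange cv := by
  obtain ⟨hOU, hlow, hupp⟩ := hf
  have hfin : D.tailProb f ≠ ∞ := ne_top_of_le_ne_top ENNReal.ofReal_ne_top hupp
  rcases eq_or_ne (D.tailProb f) 0 with h0 | h0
  -- A density of mass zero has objective zero but corresponds to no `c > 0`. It forces `l = 0`, and
  -- any feasible point of the nonlinear program dominates it; this is where feasibility is needed.
  · have hzero : D.ouObj f = 0 := measure_mono_null (fun q hq => hq.1) h0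
    rw [h0, nonpos_iff_eq_zero, ENNReal.ofReal_eq_zero] at hlow
    obtain ⟨cv, hcv⟩ := hne.resolve_left hlow.not_gt
    exact ⟨cv, hcv, by simp [hzero]⟩
  · have hc : 0 < (D.tailProb f).toReal := ENNReal.toReal_pos h0 hfin
    obtain ⟨v, hv, hle⟩ := Data.exists_nlpFeasible hc ⟨hOU, (ENNReal.ofReal_toReal hfin).symm⟩
      hg hgy hx hy0 hy
    exact ⟨((D.tailProb f).toReal, v), ⟨hc, (ENNReal.ofReal_le_iff_le_toReal hfin).1 hlow,
      ENNReal.toReal_le_of_le_ofReal (hl.trans hlu) hupp, hv⟩, hle⟩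

theorem Data.mixDensity_mem_ouFeasibleRange {l u : ℝ} {cv : ℝ × Vars n}
    (hcv : cv ∈ D.nlpFeasibleRange l u) (hy0 : ∀ k, D.y0 ≤ D.y1 k)
    (hy : ∀ k, (D.y1 k : EReal) ≤ D.y2 k) :
    D.mixDensity cv.1 cv.2.discrete ∈ D.ouFeasibleRange l u := by
  obtain ⟨hc, hl, hu, hv⟩ := hcv
  obtain ⟨hOU, hmass⟩ := D.mixDensity_mem_ouFeasible hc (Data.discrete_mem_momentFeasible hv) hy0 hy
  refine ⟨hOU, ?_, ?_⟩
  · exact hmass ▸ ENNReal.ofReal_le_ofReal hl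
  · exact hmass ▸ ENNReal.ofReal_le_ofReal hu

theorem Data.ouObj_mixDensity_discrete {c : ℝ} {v : Vars n} (hv : v ∈ D.nlpFeasible c)
    (hg : AEMeasurable D.g (volume.restrict (Ici D.x0)))
    (hgy : ∀ x, D.x0 ≤ x → (D.y0 : EReal) ≤ D.g x) :
    D.ouObj (D.mixDensity c v.discrete) = D.nlpObj c v := by
  have hQ := Data.discrete_mem_momentFeasible hv
  have := hQ.1
  rw [D.ouObj_mixDensity c hQ.2.1 hg hgy, D.momentObj_discrete]

end OUDRO

theorem mainTheorem1 (n : ℕ) (D : OUDRO.Data n)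
    (hg : AEMeasurable D.g (volume.restrict (Ici D.x0)))
    (hgy : ∀ x, D.x0 ≤ x → (D.y0 : EReal) ≤ D.g x)
    (huX : 0 ≤ D.uX) (huY : 0 ≤ D.uY)
    (hab : ∀ k, 0 ≤ D.a k ∧ D.a k ≤ D.b k ∧ D.b k ≤ 1)
    (hx : ∀ k, D.x0 ≤ D.x1 k ∧ (D.x1 k : EReal) ≤ D.x2 k)
    (hy : ∀ k, D.y0 ≤ D.y1 k ∧ (D.y1 k : EReal) ≤ D.y2 k) :
    -- part (1): the tail probability is a fixed positive number
    (∀ c : ℝ, 0 < c →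
      OUDRO.optValue (D.ouFeasible c) D.ouObj
          = OUDRO.optValue (D.momentFeasible c) (D.momentObj c) ∧
      OUDRO.optValue (D.momentFeasible c) (D.momentObj c)
          = OUDRO.optValue (D.nlpFeasible c) (D.nlpObj c) ∧
      -- the optimal value does not change if densities have to be finite everywhere
      OUDRO.optValue (D.ouFeasible c ∩ D.realValued) D.ouObj
          = OUDRO.optValue (D.ouFeasible c) D.ouObj ∧
      ∀ Q : Measure (OUDRO.Param n), OUDRO.IsOptimal (D.momentFeasible c) (D.momentObj c) Q →
        D.IsStepMixture (D.dist (D.mixDensity c Q)) c Q ∧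
        OUDRO.IsOptimal (D.ouFeasible c) D.ouObj (D.mixDensity c Q)) ∧
    -- part (2): the tail probability ranges over an interval
    (∀ l u : ℝ, 0 ≤ l → l ≤ u →
      ((0 < l ∨ (D.nlpFeasibleRange l u).Nonempty) →
        OUDRO.optValue (D.ouFeasibleRange l u) D.ouObj
          = OUDRO.optValue (D.nlpFeasibleRange l u) D.nlpObjRange ∧
        OUDRO.optValue (D.ouFeasibleRange l u ∩ D.realValued) D.ouObj
          = OUDRO.optValue (D.ouFeasibleRange l u) D.ouObj) ∧
      ∀ (c : ℝ) (v : OUDRO.Vars n),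
        OUDRO.IsOptimal (D.nlpFeasibleRange l u) D.nlpObjRange (c, v) →
          D.IsStepMixture (D.dist (D.mixDensity c v.discrete)) c v.discrete ∧
          OUDRO.IsOptimal (D.ouFeasibleRange l u) D.ouObj (D.mixDensity c v.discrete) ∧
          D.mixDensity c v.discrete ∈ D.realValued) := by
  have hx2 := fun k => (hx k).2
  have hy0 := fun k => (hy k).1
  have hy2 := fun k => (hy k).2
  refine ⟨fun c hc => ?_, fun l u hl hlu => ⟨fun hne => ?_, fun c v hopt => ?_⟩⟩
  · have hON : ∀ f ∈ D.ouFeasible c, ∃ v ∈ D.nlpFeasible c, D.ouObj f ≤ D.nlpObj c v :=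
      fun f hf => OUDRO.Data.exists_nlpFeasible hc hf hg hgy hx2 hy0 hy2
    have hNM : ∀ v ∈ D.nlpFeasible c, ∃ Q ∈ D.momentFeasible c, D.nlpObj c v ≤ D.momentObj c Q :=
      fun v hv => ⟨v.discrete, OUDRO.Data.discrete_mem_momentFeasible hv,
        (D.momentObj_discrete c v).ge⟩
    have hMO : ∀ Q ∈ D.momentFeasible c, D.mixDensity c Q ∈ D.ouFeasible c ∧
        D.ouObj (D.mixDensity c Q) = D.momentObj c Q := fun Q hQ => by
      have := hQ.1
      exact ⟨D.mixDensity_mem_ouFeasible hc hQ hy0 hy2, D.ouObj_mixDensity c hQ.2.1 hg hgy⟩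
    have h1 := OUDRO.optValue_le_optValue hON
    have h2 := OUDRO.optValue_le_optValue hNM
    have h3 : OUDRO.optValue (D.momentFeasible c) (D.momentObj c) ≤
        OUDRO.optValue (D.ouFeasible c) D.ouObj := OUDRO.optValue_le_optValue fun Q hQ =>
      ⟨_, (hMO Q hQ).1, (hMO Q hQ).2.ge⟩
    -- The nonlinear program is compared directly with the densities finite everywhere; together
    -- with `h1` this squeezes their optimal value.
    have h4 : OUDRO.optValue (D.nlpFeasible c) (D.nlpObj c) ≤
        OUDRO.optValue (D.ouFeasible c ∩ D.realValued) D.ouObj :=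
      OUDRO.optValue_le_optValue fun v hv =>
        ⟨_, ⟨(hMO _ (OUDRO.Data.discrete_mem_momentFeasible hv)).1,
          OUDRO.Data.mixDensity_discrete_mem_realValued hv⟩,
          (OUDRO.Data.ouObj_mixDensity_discrete hv hg hgy).ge⟩
    have h5 : OUDRO.optValue (D.ouFeasible c ∩ D.realValued) D.ouObj ≤
        OUDRO.optValue (D.ouFeasible c) D.ouObj :=
      OUDRO.optValue_le_optValue fun f hf => ⟨f, hf.1, le_rfl⟩
    refine ⟨le_antisymm (h1.trans h2) h3, le_antisymm (h3.trans h1) h2,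
      le_antisymm h5 (h1.trans h4), fun Q hQ => ⟨?_, (hMO Q hQ.1).1, fun f hf => ?_⟩⟩
    · have := hQ.1.1
      exact D.isStepMixture_mixDensity c hQ.1.2.1
    · obtain ⟨v, hv, hfv⟩ := hON f hf
      obtain ⟨Q', hQ', hvQ⟩ := hNM v hv
      rw [(hMO Q hQ.1).2]
      exact (hfv.trans hvQ).trans (hQ.2 Q' hQ')
  · have h1 : OUDRO.optValue (D.ouFeasibleRange l u) D.ouObj ≤
        OUDRO.optValue (D.nlpFeasibleRange l u) D.nlpObjRange :=
      OUDRO.optValue_le_optValue fun f hf =>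
        OUDRO.Data.exists_nlpFeasibleRange hl hlu hne hf hg hgy hx2 hy0 hy2
    have h2 : OUDRO.optValue (D.nlpFeasibleRange l u) D.nlpObjRange ≤
        OUDRO.optValue (D.ouFeasibleRange l u ∩ D.realValued) D.ouObj :=
      OUDRO.optValue_le_optValue fun cv hcv =>
        ⟨_, ⟨OUDRO.Data.mixDensity_mem_ouFeasibleRange hcv hy0 hy2,
          OUDRO.Data.mixDensity_discrete_mem_realValued hcv.2.2.2⟩,
          (OUDRO.Data.ouObj_mixDensity_discrete hcv.2.2.2 hg hgy).ge⟩
    have h3 : OUDRO.optValue (D.ouFeasibleRange l u ∩ D.realValued) D.ouObj ≤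
        OUDRO.optValue (D.ouFeasibleRange l u) D.ouObj :=
      OUDRO.optValue_le_optValue fun f hf => ⟨f, hf.1, le_rfl⟩
    exact ⟨le_antisymm h1 (h2.trans h3), le_antisymm h3 (h1.trans h2)⟩
  · have hv := hopt.1.2.2.2
    have hQ := OUDRO.Data.discrete_mem_momentFeasible hv
    have := hQ.1
    refine ⟨D.isStepMixture_mixDensity c hQ.2.1,
      ⟨OUDRO.Data.mixDensity_mem_ouFeasibleRange hopt.1 hy0 hy2, fun f hf => ?_⟩,
      OUDRO.Data.mixDensity_discrete_mem_realValued hv⟩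
    -- The optimal solution itself witnesses feasibility, so no assumption on `l` is needed here.
    obtain ⟨cv, hcv, hle⟩ := OUDRO.Data.exists_nlpFeasibleRange hl hlu (Or.inr ⟨_, hopt.1⟩) hf
      hg hgy hx2 hy0 hy2
    rw [OUDRO.Data.ouObj_mixDensity_discrete hv hg hgy]
    exact hle.trans (hopt.2 cv hcv)
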